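/- Proposition (Normal VT). Let $n\ge 2$, $\sigma>0$, $c>0$. The means $\mu_1,\dots,\mu_n$ of $n$ arms are i.i.d. standard normal random variables and, conditionally on the means, all observations are independent, those of arm $i$ being normal with mean $\mu_i$ and variance $\sigma^2$. Let $S_i(t)$ be the sum of the first $t$ observations of arm $i$. The VT rule with threshold $c$ starts with all arms; in round $t=1,2,\dots$ it samples each remaining arm once and then eliminates every remaining arm $i$ for which there is another remaining arm $j$ with $S_i(t)<S_j(t)-c$; it stops when a single arm remains and recommends that arm. Let $C$ be the event that VT recommends the arm with the largest mean. Let $B$ be the event that the arm with the largest mean, call it arm $0$, beats every other arm $i$, in the sense that, if all arms are sampled in all rounds, $S_0(t)-S_i(t)$ exceeds $c$ at the first time $t$ at which it leaves $[-c,c]$. Let $\Phi$ be the standard normal distribution function, $R(a)=\Phi(a)/(1-\Phi(a))$, and for $\mu>0$ $$LB(\mu)=\frac{e^{\mu c/\sigma^2}-1}{e^{\mu c/\sigma^2}-R\!\left(-\frac{\mu}{\sigma\sqrt2}\right)e^{-\mu c/\sigma^2}},\qquad UB(\mu)=\frac{e^{\mu c/\sigma^2}R\!\left(\frac{\mu}{\sigma\sqrt2}\right)-1}{e^{\mu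 c/\sigma^2}R\!\left(\frac{\mu}{\sigma\sqrt2}\right)-e^{-\mu c/\sigma^2}}.$$ Let $U,V$ be independent uniform $(0,1)$ random variables and $$X=\Phi^{-1}(U^{1/n})-\Phi^{-1}(U^{1/n}V),\qquad Y=\Phi^{-1}(U^{1/n})-\Phi^{-1}(U^{1/n}V^{1/(n-1)}).$$ Then $LB(X)$ and $UB(Y)$ are integrable, and $$\mathbb P(C)\ \ge\ \mathbb P(B)\ \ge\ \bigl(\mathbb E[LB(X)]\bigr)^{n-1},\qquad \mathbb P(B)\ \le\ \mathbb E[UB(Y)].$$ -/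

import Mathlib

open MeasureTheory ProbabilityTheory
open scoped NNReal

namespace NormalVT

noncomputable section

/-- The standard normal distribution function `Φ`. -/
def Phi (x : ℝ) : ℝ := cdf (gaussianReal 0 1) x

/-- The inverse `Φ⁻¹` of the standard normal distribution function, as the quantile function
(for `0 < p < 1` this is the unique `x` with `Φ x = p`). -/
def PhiInv (p : ℝ) : ℝ := sInf {x : ℝ | p ≤ Phi x}

/-- `R(a) = Φ(a) / (1 - Φ(a))`. -/
def R (a : ℝ) : ℝ := Phi a / (1 - Phi a)

/-- The lower tail bound for a random walk with normal increments of mean `m` and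
variance `2σ²` and thresholds `±c`. -/
def LB (c σ m : ℝ) : ℝ :=
  (Real.exp (m * c / σ ^ 2) - 1) /
    (Real.exp (m * c / σ ^ 2) - R (-(m / (σ * √2))) * Real.exp (-(m * c / σ ^ 2)))

/-- The upper tail bound for a random walk with normal increments of mean `m` and
variance `2σ²` and thresholds `±c`. -/
def UB (c σ m : ℝ) : ℝ :=
  (Real.exp (m * c / σ ^ 2) * R (m / (σ * √2)) - 1) /
    (Real.exp (m * c / σ ^ 2) * R (m / (σ * √2)) - Real.exp (-(m * c / σ ^ 2)))

/-- The Bayesian normal bandit with `n` arms: the means `θ i` are i.i.d. standard normal and,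
conditionally on the vector of means being `m`, the observations `rew i t` are independent
with `rew i t` normal of mean `m i` and variance `σ²`. The conditional law is expressed by
disintegrating the joint law of means and observations over the law of the means. -/
structure IsNormalBandit {Ω : Type*} [MeasurableSpace Ω] (P : Measure Ω) {n : ℕ} (σ : ℝ≥0)
    (θ : Fin n → Ω → ℝ) (rew : Fin n → ℕ → Ω → ℝ) : Prop where
  measurable_mean : ∀ i, Measurable (θ i)
  measurable_rew : ∀ i t, Measurable (rew i t)
  joint_law : ∀ (A : Set (Fin n → ℝ)) (D : Set (Fin n × ℕ → ℝ)),
    MeasurableSet A → MeasurableSet D →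
    P {ω | (fun i => θ i ω) ∈ A ∧ (fun p : Fin n × ℕ => rew p.1 p.2 ω) ∈ D} =
      ∫⁻ m in A, Measure.infinitePi (fun p : Fin n × ℕ => gaussianReal (m p.1) (σ ^ 2)) D
        ∂(Measure.pi fun _ : Fin n => gaussianReal 0 1)

/-- The sum of the first `t` observations of arm `i`, for the table of observations `x`. -/
def partialSum {n : ℕ} (x : Fin n → ℕ → ℝ) (i : Fin n) (t : ℕ) : ℝ :=
  ∑ s ∈ Finset.range t, x i s

/-- The arms remaining after `t` rounds of the VT rule with threshold `c`. In every round each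
remaining arm is sampled once (so after the sampling of round `t` the sum of a remaining arm
consists of its first `t` observations), and then every remaining arm is eliminated whose sum
is more than `c` behind the sum of some other remaining arm. Once a single arm remains
nothing changes any more. -/
def remaining {n : ℕ} (c : ℝ) (x : Fin n → ℕ → ℝ) : ℕ → Set (Fin n)
  | 0 => Set.univ
  | t + 1 => {i | i ∈ remaining c x t ∧ ¬ ∃ j ∈ remaining c x t, j ≠ i ∧
      partialSum x i (t + 1) < partialSum x j (t + 1) - c}

/-- The VT rule stops with arm `i` as the only remaining arm. -/
def Recommends {n : ℕ} (c : ℝ) (x : Fin n → ℕ → ℝ) (i : Fin n) : Prop :=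
  ∃ t, remaining c x t = {i}

/-- Arm `i` beats arm `j` in their gambler's ruin game: at the first time at which the
difference of their sums (all arms being sampled in all rounds) leaves `[-c, c]`, it
exceeds `c`. -/
def Beats {n : ℕ} (c : ℝ) (x : Fin n → ℕ → ℝ) (i j : Fin n) : Prop :=
  ∃ t, c < partialSum x i t - partialSum x j t ∧
    ∀ s < t, |partialSum x i s - partialSum x j s| ≤ c

/-- Arm `i` has the largest mean. -/
def IsBest {n : ℕ} (m : Fin n → ℝ) (i : Fin n) : Prop := ∀ j, m j ≤ m i

/-- The event `C` of a correct choice: VT recommends the arm with the largest mean. -/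
def correctEvent {Ω : Type*} {n : ℕ} (c : ℝ) (θ : Fin n → Ω → ℝ) (rew : Fin n → ℕ → Ω → ℝ) :
    Set Ω :=
  {ω | ∃ i, IsBest (fun j => θ j ω) i ∧ Recommends c (fun j t => rew j t ω) i}

/-- The event `B`: the arm with the largest mean beats each of the other arms. -/
def beatsAllEvent {Ω : Type*} {n : ℕ} (c : ℝ) (θ : Fin n → Ω → ℝ) (rew : Fin n → ℕ → Ω → ℝ) :
    Set Ω :=
  {ω | ∃ i, IsBest (fun j => θ j ω) i ∧ ∀ j, j ≠ i → Beats c (fun j t => rew j t ω) i j}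

/-- `Φ⁻¹(u^{1/n}) - Φ⁻¹(u^{1/n} v)`. -/
def gapX (n : ℕ) (u v : ℝ) : ℝ :=
  PhiInv (u ^ (1 / (n : ℝ))) - PhiInv (u ^ (1 / (n : ℝ)) * v)

/-- `Φ⁻¹(u^{1/n}) - Φ⁻¹(u^{1/n} v^{1/(n-1)})`. -/
def gapY (n : ℕ) (u v : ℝ) : ℝ :=
  PhiInv (u ^ (1 / (n : ℝ))) - PhiInv (u ^ (1 / (n : ℝ)) * v ^ (1 / ((n : ℝ) - 1)))

end

end NormalVT

/-! The inclusion of `B` in `C` is deterministic: an arm that beats all others is never eliminated,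
and it eliminates each of the others (`recommends_of_beats`).

For the bounds on `P(B)`, fix the means first. The difference `W` of the sums of two arms is a
random walk with increments `N(μ, v)`, `v = 2σ²`, and `exp(-(2μ/v) W)` is a martingale with mean
one. Stopping it at the exit from `[-c, c]` relates the exit probabilities to the overshoots. When a
normal step crosses a level at distance `d ≥ 0`, the overshoot is stochastically smaller than at
distance `0`, by monotonicity of the likelihood ratio. At distance `0` its exponential moment is
explicit: `R(-μ/√v)` at the upper end, `R(μ/√v)` at the lower end (`overshoot_up`,
`overshoot_down`). This estimate at one end, and neglect of the overshoot at the other, give `LB`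
and `UB` as bounds for the probability of winning a game (`IsWalk.bounds`).

All games of the best arm are increasing events in its own observations and decreasing in those of
the other arms. Harris' inequality therefore bounds the probability of winning all of them below by
the product of the `LB`s (`prod_tableLaw_le`). For the upper bound only the game against the second
best arm is kept.

Finally the means are integrated out. Given the largest mean `x`, the others are i.i.d. normal
conditioned to lie below `x`, so the product of the `LB`s integrates to a power of one conditional
expectation, and Jensen's inequality moves the power outside. By the probability integral transform,
`X` is the gap between the largest mean and a randomly chosen other one, and `Y` the gap between the
two largest. -/

namespace NormalVT
open scoped ENNReal

/-! ### Association inequalities on the line -/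

theorem ennreal_mul_add_mul_le {a b c d : ℝ≥0∞} (hab : a ≤ b) (hcd : c ≤ d) :
    a * d + b * c ≤ a * c + b * d := by
  obtain ⟨e, rfl⟩ := exists_add_of_le hab
  obtain ⟨g, rfl⟩ := exists_add_of_le hcd
  calc a * (c + g) + (a + e) * c ≤ a * (c + g) + (a + e) * c + e * g := le_self_add
    _ = a * c + (a + e) * (c + g) := by ring

/-- Chebyshev's association inequality. -/
theorem lintegral_mul_lintegral_le_of_monovary {α : Type*} [MeasurableSpace α] (μ : Measure α)
    [SFinite μ] {f g : α → ℝ≥0∞} (hf : Measurable f) (hg : Measurable g)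
    (h : ∀ x y, (f x ≤ f y ∧ g x ≤ g y) ∨ (f y ≤ f x ∧ g y ≤ g x)) :
    (∫⁻ x, f x ∂μ) * (∫⁻ x, g x ∂μ) ≤ μ Set.univ * ∫⁻ x, f x * g x ∂μ := by
  -- This is `(f x - f y) * (g x - g y) ≥ 0` rearranged so that no subtraction occurs; integrated
  -- over the product measure it gives twice the claim.
  have key : ∀ z : α × α, f z.1 * g z.2 + g z.1 * f z.2 ≤
      (fun _ => 1) z.1 * (f z.2 * g z.2) + (f z.1 * g z.1) * (fun _ => 1) z.2 := by
    rintro ⟨x, y⟩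
    simp only [one_mul, mul_one]
    rcases h x y with ⟨h1, h2⟩ | ⟨h1, h2⟩
    · have := ennreal_mul_add_mul_le h1 h2
      rw [mul_comm (g x), add_comm (f y * g y)]; exact this
    · have := ennreal_mul_add_mul_le h1 h2
      rw [mul_comm (g x), add_comm (f x * g y)]; exact this
  have := lintegral_mono (μ := μ.prod μ) key
  rw [lintegral_add_left (by fun_prop), lintegral_add_left (by fun_prop),
    lintegral_prod_mul (by fun_prop) (by fun_prop), lintegral_prod_mul (by fun_prop) (by fun_prop),
    lintegral_prod_mul (f := fun _ => 1) (g := fun x => f x * g x) (by fun_prop) (by fun_prop),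
    lintegral_prod_mul (f := fun x => f x * g x) (g := fun _ => 1) (by fun_prop) (by fun_prop)]
    at this
  simp only [lintegral_const, one_mul] at this
  rw [mul_comm (∫⁻ x, g x ∂μ), mul_comm _ (μ Set.univ), ← two_mul, ← two_mul] at this
  exact (ENNReal.mul_le_mul_iff_right (by simp) (by simp)).1 this

/-- Chebyshev's association inequality, for functions that vary in opposite directions. -/
theorem lintegral_mul_le_of_antivary {α : Type*} [MeasurableSpace α] (μ : Measure α)
    [SFinite μ] {f g : α → ℝ≥0∞} (hf : Measurable f) (hg : Measurable g)
    (h : ∀ x y, (f x ≤ f y ∧ g y ≤ g x) ∨ (f y ≤ f x ∧ g x ≤ g y)) :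
    μ Set.univ * ∫⁻ x, f x * g x ∂μ ≤ (∫⁻ x, f x ∂μ) * (∫⁻ x, g x ∂μ) := by
  have key : ∀ z : α × α,
      (fun _ => 1) z.1 * (f z.2 * g z.2) + (f z.1 * g z.1) * (fun _ => 1) z.2 ≤
      f z.1 * g z.2 + g z.1 * f z.2 := by
    rintro ⟨x, y⟩
    simp only [one_mul, mul_one]
    rcases h x y with ⟨h1, h2⟩ | ⟨h1, h2⟩
    · have := ennreal_mul_add_mul_le h1 h2
      rw [mul_comm (g x), add_comm (f y * g y), add_comm (f x * g y), add_comm]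
      simpa [add_comm] using this
    · have := ennreal_mul_add_mul_le h1 h2
      rw [mul_comm (g x)]; simpa [add_comm] using this
  have := lintegral_mono (μ := μ.prod μ) key
  rw [lintegral_add_left (by fun_prop), lintegral_add_left (by fun_prop),
    lintegral_prod_mul (by fun_prop) (by fun_prop), lintegral_prod_mul (by fun_prop) (by fun_prop),
    lintegral_prod_mul (f := fun _ => 1) (g := fun x => f x * g x) (by fun_prop) (by fun_prop),
    lintegral_prod_mul (f := fun x => f x * g x) (g := fun _ => 1) (by fun_prop) (by fun_prop)]
    at this
  simp only [lintegral_const, one_mul] at this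
  rw [mul_comm (∫⁻ x, g x ∂μ), mul_comm _ (μ Set.univ), ← two_mul, ← two_mul] at this
  exact (ENNReal.mul_le_mul_iff_right (by simp) (by simp)).1 this

/-! ### Harris' inequality for product measures -/

section Harris

variable {ι : Type*} [DecidableEq ι] (μ : ι → Measure ℝ)
  (r : ι → ℝ → ℝ → Prop)

/-- `f` is increasing for the coordinatewise relation given by `r`. -/
def IsIncreasing {ι : Type*} (r : ι → ℝ → ℝ → Prop) (f : (ι → ℝ) → ℝ≥0∞) : Prop :=
  ∀ x y, (∀ i, r i (x i) (y i)) → f x ≤ f y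

variable {r}

theorem IsIncreasing.lmarginal (hr : ∀ i a, r i a a) {f : (ι → ℝ) → ℝ≥0∞}
    (hf : IsIncreasing r f) (s : Finset ι) : IsIncreasing r (lmarginal μ s f) := by
  intro x y hxy
  refine lintegral_mono fun z => hf _ _ fun i => ?_
  by_cases hi : i ∈ s <;> simp [Function.updateFinset, hi, hr, hxy]

variable [∀ i, IsProbabilityMeasure (μ i)]

/-- Harris' inequality for finitely many coordinates. -/
theorem lmarginal_mul_lmarginal_le (hr : ∀ i a b, r i a b ∨ r i b a) {f g : (ι → ℝ) → ℝ≥0∞}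
    (hfm : Measurable f) (hgm : Measurable g) (hf : IsIncreasing r f) (hg : IsIncreasing r g)
    (s : Finset ι) (x : ι → ℝ) :
    lmarginal μ s f x * lmarginal μ s g x ≤ lmarginal μ s (fun z => f z * g z) x := by
  have hrr : ∀ i a, r i a a := fun i a => by simpa using hr i a a
  induction s using Finset.induction_on generalizing x with
  | empty => simp
  | insert i s hi ih =>
    rw [lmarginal_insert _ hfm hi, lmarginal_insert _ hgm hi,
      lmarginal_insert _ (by fun_prop) hi]
    have hF := (hfm.lmarginal μ (s := s)).comp (measurable_update x (a := i))
    have hG := (hgm.lmarginal μ (s := s)).comp (measurable_update x (a := i))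
    have hmono : ∀ {h : (ι → ℝ) → ℝ≥0∞}, IsIncreasing r h → ∀ a b, r i a b →
        lmarginal μ s h (Function.update x i a) ≤ lmarginal μ s h (Function.update x i b) := by
      intro h hh a b hab
      refine hh.lmarginal μ hrr s _ _ fun j => ?_
      by_cases hj : j = i
      · subst hj; simpa using hab
      · simp [hj, hrr]
    -- Since `r i` is total, both marginals are monotone along coordinate `i` in the same direction,
    -- so the one-dimensional inequality applies to them.
    have := lintegral_mul_lintegral_le_of_monovary (μ i) hF hG fun a b => by
      rcases hr i a b with h | h
      · exact Or.inl ⟨hmono hf _ _ h, hmono hg _ _ h⟩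
      · exact Or.inr ⟨hmono hf _ _ h, hmono hg _ _ h⟩
    simp only [Function.comp_def, measure_univ, one_mul] at this
    exact this.trans (lintegral_mono fun a => ih _)

/-- A function of the coordinates in `s` does not see the base point of the marginal, so `0` serves.
This reduces infinite products to finite ones. -/
theorem lintegral_infinitePi_eq_lmarginal {f : (ι → ℝ) → ℝ≥0∞} (hf : Measurable f)
    (s : Finset ι) (hs : ∀ x y, (∀ i ∈ s, x i = y i) → f x = f y) :
    ∫⁻ x, f x ∂(Measure.infinitePi μ) = lmarginal μ s f 0 := by
  rw [lmarginal, ← Measure.infinitePi_map_restrict, lintegral_map]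
  · refine lintegral_congr fun x => hs _ _ fun i hi => ?_
    simp [Function.updateFinset, hi]
  · exact hf.comp (measurable_updateFinset)
  · fun_prop

/-- Harris' inequality for finitely many increasing events. -/
theorem prod_infinitePi_le_infinitePi_iInter (hr : ∀ i a b, r i a b ∨ r i b a)
    (s : Finset ι) {κ : Type*} (J : Finset κ) (B : κ → Set (ι → ℝ))
    (hB : ∀ j, MeasurableSet (B j)) (hs : ∀ j x y, (∀ i ∈ s, x i = y i) → (x ∈ B j ↔ y ∈ B j))
    (hinc : ∀ j x y, (∀ i, r i (x i) (y i)) → x ∈ B j → y ∈ B j) :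
    ∏ j ∈ J, Measure.infinitePi μ (B j) ≤ Measure.infinitePi μ (⋂ j ∈ J, B j) := by
  classical
  induction J using Finset.induction_on with
  | empty => simp
  | insert k J hk ih =>
    rw [Finset.prod_insert hk]
    refine (mul_le_mul_right ih _).trans ?_
    set D := ⋂ j ∈ J, B j with hD
    have hDm : MeasurableSet D := Finset.measurableSet_biInter _ fun j _ => hB j
    have hDs : ∀ x y, (∀ i ∈ s, x i = y i) → (x ∈ D ↔ y ∈ D) := fun x y h => by
      simp only [hD, Set.mem_iInter]
      exact forall_congr' fun j => imp_congr_right fun _ => hs j x y h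
    have hDi : ∀ x y, (∀ i, r i (x i) (y i)) → x ∈ D → y ∈ D := fun x y h hx => by
      simp only [hD, Set.mem_iInter] at hx ⊢
      exact fun j hj => hinc j x y h (hx j hj)
    have hunion : ⋂ j ∈ insert k J, B j = B k ∩ D := by simp [hD]
    have hind : ∀ (E : Set (ι → ℝ)), (∀ x y, (∀ i, r i (x i) (y i)) → x ∈ E → y ∈ E) →
        IsIncreasing r (E.indicator fun _ => 1) := fun E hE x y h => by
      by_cases hx : x ∈ E
      · simp [hx, hE x y h hx]
      · simp [hx]
    have hcg : ∀ (E : Set (ι → ℝ)), (∀ x y, (∀ i ∈ s, x i = y i) → (x ∈ E ↔ y ∈ E)) →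
        ∀ x y, (∀ i ∈ s, x i = y i) →
          E.indicator (fun _ => (1 : ℝ≥0∞)) x = E.indicator (fun _ => 1) y := fun E hE x y h => by
      by_cases hx : x ∈ E
      · simp [hx, (hE x y h).1 hx]
      · simp [hx, mt (hE x y h).2 hx]
    have key : ∀ E : Set (ι → ℝ), MeasurableSet E →
        (∀ x y, (∀ i ∈ s, x i = y i) → (x ∈ E ↔ y ∈ E)) →
        Measure.infinitePi μ E = lmarginal μ s (E.indicator fun _ => 1) 0 := fun E hE hEs => by
      rw [← lintegral_infinitePi_eq_lmarginal μ (measurable_const.indicator hE) s (hcg E hEs),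
        lintegral_indicator_const hE, one_mul]
    rw [hunion, key _ (hB k) (hs k), key _ hDm hDs, key _ ((hB k).inter hDm)
      fun x y h => and_congr (hs k x y h) (hDs x y h)]
    refine (lmarginal_mul_lmarginal_le μ hr (measurable_const.indicator (hB k))
      (measurable_const.indicator hDm) (hind _ (hinc k)) (hind _ hDi) s 0).trans_eq ?_
    congr 1
    ext x
    by_cases h1 : x ∈ B k <;> by_cases h2 : x ∈ D <;> simp [h1, h2]

end Harris

/-! ### The standard normal distribution function -/

theorem ofReal_Phi (x : ℝ) : ENNReal.ofReal (Phi x) = gaussianReal 0 1 (Set.Iic x) :=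
  ofReal_cdf _ x

theorem Phi_eq_integral (x : ℝ) : Phi x = ∫ y in Set.Iic x, gaussianPDFReal 0 1 y := by
  rw [Phi, cdf_eq_real, Measure.real, gaussianReal_apply_eq_integral 0 one_ne_zero,
    ENNReal.toReal_ofReal (integral_nonneg fun y => gaussianPDFReal_nonneg _ _ _)]

theorem continuous_gaussianPDFReal (m : ℝ) (v : ℝ≥0) : Continuous (gaussianPDFReal m v) := by
  unfold gaussianPDFReal; fun_prop

theorem hasDerivAt_Phi (x : ℝ) : HasDerivAt Phi (gaussianPDFReal 0 1 x) x := by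
  have h : Phi = fun y => Phi 0 + ∫ t in (0 : ℝ)..y, gaussianPDFReal 0 1 t := by
    ext y
    have hi := integrable_gaussianPDFReal 0 1
    rw [Phi_eq_integral, Phi_eq_integral,
      ← intervalIntegral.integral_Iic_sub_Iic hi.integrableOn hi.integrableOn]
    ring
  rw [h]
  exact ((continuous_gaussianPDFReal 0 1).integral_hasStrictDerivAt 0 x).hasDerivAt.const_add _

theorem continuous_Phi : Continuous Phi :=
  continuous_iff_continuousAt.2 fun x => (hasDerivAt_Phi x).continuousAt

theorem strictMono_Phi : StrictMono Phi :=
  strictMono_of_deriv_pos fun x => by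
    rw [(hasDerivAt_Phi x).deriv]; exact gaussianPDFReal_pos _ _ _ one_ne_zero

theorem Phi_pos (x : ℝ) : 0 < Phi x :=
  (cdf_nonneg _ (x - 1)).trans_lt (strictMono_Phi (by linarith))

theorem Phi_lt_one (x : ℝ) : Phi x < 1 :=
  (strictMono_Phi (by linarith : x < x + 1)).trans_le (cdf_le_one _ _)

theorem exists_Phi_eq {p : ℝ} (h0 : 0 < p) (h1 : p < 1) : ∃ x, Phi x = p := by
  obtain ⟨a, ha⟩ := ((tendsto_cdf_atBot (gaussianReal 0 1)).eventually_lt_const h0).exists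
  obtain ⟨b, hb⟩ := ((tendsto_cdf_atTop (gaussianReal 0 1)).eventually_const_lt h1).exists
  exact mem_range_of_exists_le_of_exists_ge continuous_Phi ⟨a, ha.le⟩ ⟨b, hb.le⟩

theorem PhiInv_Phi (x : ℝ) : PhiInv (Phi x) = x := by
  have : {y : ℝ | Phi x ≤ Phi y} = Set.Ici x := by
    ext y; simp [strictMono_Phi.le_iff_le]
  rw [PhiInv, this, csInf_Ici]

theorem Phi_PhiInv {p : ℝ} (h0 : 0 < p) (h1 : p < 1) : Phi (PhiInv p) = p := by
  obtain ⟨x, rfl⟩ := exists_Phi_eq h0 h1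
  rw [PhiInv_Phi]

theorem Phi_image_Iio (x : ℝ) : Phi '' Set.Iio x = Set.Ioo 0 (Phi x) := by
  ext p
  constructor
  · rintro ⟨y, hy, rfl⟩
    exact ⟨Phi_pos y, strictMono_Phi hy⟩
  · rintro ⟨h0, h1⟩
    obtain ⟨y, rfl⟩ := exists_Phi_eq h0 (h1.trans (Phi_lt_one x))
    exact ⟨y, strictMono_Phi.lt_iff_lt.1 h1, rfl⟩

theorem Phi_image_univ : Phi '' Set.univ = Set.Ioo 0 1 := by
  ext p
  constructor
  · rintro ⟨y, -, rfl⟩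
    exact ⟨Phi_pos y, Phi_lt_one y⟩
  · rintro ⟨h0, h1⟩
    obtain ⟨y, rfl⟩ := exists_Phi_eq h0 h1
    exact ⟨y, trivial, rfl⟩

theorem PhiInv_lt_PhiInv {p q : ℝ} (h0 : 0 < p) (hpq : p < q) (h1 : q < 1) :
    PhiInv p < PhiInv q := by
  rw [← strictMono_Phi.lt_iff_lt, Phi_PhiInv h0 (hpq.trans h1), Phi_PhiInv (h0.trans hpq) h1]
  exact hpq

theorem PhiInv_of_nonpos {p : ℝ} (h : p ≤ 0) : PhiInv p = 0 := by
  have : {x : ℝ | p ≤ Phi x} = Set.univ := Set.eq_univ_of_forall fun x => h.trans (Phi_pos x).le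
  rw [PhiInv, this, Real.sInf_univ]

theorem PhiInv_of_one_le {p : ℝ} (h : 1 ≤ p) : PhiInv p = 0 := by
  have : {x : ℝ | p ≤ Phi x} = ∅ :=
    Set.eq_empty_of_forall_notMem fun x hx => ((Phi_lt_one x).trans_le h).not_ge hx
  rw [PhiInv, this, Real.sInf_empty]

theorem measurable_PhiInv : Measurable PhiInv := by
  refine measurable_of_Iic fun x => ?_
  -- Outside `(0, 1)` the quantile function has the default value `0`, so that part of the preimage
  -- is everything or nothing according to the sign of `x`.
  have : PhiInv ⁻¹' Set.Iic x =
      (Set.Ioo 0 1 ∩ Set.Iic (Phi x)) ∪ ((Set.Ioo 0 1)ᶜ ∩ {_p | 0 ≤ x}) := by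
    ext p
    by_cases hp : p ∈ Set.Ioo (0 : ℝ) 1
    · have := strictMono_Phi.le_iff_le (a := PhiInv p) (b := x)
      rw [Phi_PhiInv hp.1 hp.2] at this
      simp only [Set.mem_preimage, Set.mem_Iic, Set.mem_union, Set.mem_inter_iff, hp,
        Set.mem_compl_iff, true_and, not_true, false_and, or_false, this]
    · have h0 : PhiInv p = 0 := by
        by_cases h : p ≤ 0
        · exact PhiInv_of_nonpos h
        · exact PhiInv_of_one_le (not_lt.1 fun h1 => hp ⟨not_le.1 h, h1⟩)
      simp only [Set.mem_preimage, Set.mem_Iic, Set.mem_union, Set.mem_inter_iff, hp,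
        Set.mem_compl_iff, false_and, not_false_iff, true_and, false_or, h0, Set.mem_ofPred_eq]
  rw [this]
  exact (measurableSet_Ioo.inter measurableSet_Iic).union
    (measurableSet_Ioo.compl.inter (MeasurableSet.const _))

theorem measurable_Phi : Measurable Phi := strictMono_Phi.monotone.measurable

/-- The probability integral transform. -/
theorem setLIntegral_Phi {s : Set ℝ} (hs : MeasurableSet s) (f : ℝ → ℝ≥0∞) :
    ∫⁻ p in Phi '' s, f p = ∫⁻ x in s, f (Phi x) ∂(gaussianReal 0 1) := by
  rw [lintegral_image_eq_lintegral_abs_deriv_mul hs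
    (fun x _ => (hasDerivAt_Phi x).hasDerivWithinAt) strictMono_Phi.injective.injOn,
    gaussianReal_of_var_ne_zero 0 one_ne_zero,
    setLIntegral_withDensity_eq_setLIntegral_mul_non_measurable₀ _
      (measurable_gaussianPDF 0 1).aemeasurable _ hs (by simp [gaussianPDF])]
  refine lintegral_congr fun x => ?_
  simp [gaussianPDF, abs_of_nonneg (gaussianPDFReal_nonneg 0 1 x)]

theorem Phi_neg (x : ℝ) : Phi (-x) = 1 - Phi x := by
  have h1 : gaussianReal 0 1 (Set.Iic (-x)) = gaussianReal 0 1 (Set.Ici x) := by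
    conv_lhs => rw [show gaussianReal 0 1 = (gaussianReal 0 1).map (fun x => -x) by
      rw [gaussianReal_map_neg, neg_zero]]
    rw [Measure.map_apply measurable_neg measurableSet_Iic]
    simp
  have := nullSingletonClass_gaussianReal (μ := 0) (v := 1) one_ne_zero
  rw [Phi, Phi, cdf_eq_real, cdf_eq_real, Measure.real, h1, ← measure_congr Ioi_ae_eq_Ici,
    ← Set.compl_Iic, ← Measure.real, probReal_compl_eq_one_sub measurableSet_Iic]

/-! ### Exponential tilts of normal distributions -/

/-- The exponential weight is the density of `N(m + ηv, v)` with respect to `N(m, v)`. Reflection of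
the mean (`η = -2m/v`) and translation by `d` (`η = ±d/v`) are both of this form. -/
theorem lintegral_gaussianReal_tilt (m η : ℝ) {v : ℝ≥0} (hv : v ≠ 0) {f : ℝ → ℝ≥0∞}
    (hf : Measurable f) :
    ∫⁻ x, f x ∂(gaussianReal (m + η * v) v) =
      ∫⁻ x, ENNReal.ofReal (Real.exp (η * x - η * m - η ^ 2 * v / 2)) * f x
        ∂(gaussianReal m v) := by
  rw [gaussianReal_of_var_ne_zero _ hv, gaussianReal_of_var_ne_zero _ hv,
    lintegral_withDensity_eq_lintegral_mul _ (measurable_gaussianPDF _ _) hf,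
    lintegral_withDensity_eq_lintegral_mul _ (measurable_gaussianPDF _ _) (by fun_prop)]
  refine lintegral_congr fun x => ?_
  have hv' : (v : ℝ) ≠ 0 := by exact_mod_cast hv
  simp only [Pi.mul_apply, gaussianPDF, ← mul_assoc]
  rw [← ENNReal.ofReal_mul (gaussianPDFReal_nonneg _ _ _)]
  congr 2
  simp only [gaussianPDFReal]
  rw [mul_assoc (_⁻¹), ← Real.exp_add]
  congr 2
  field_simp
  ring

theorem lintegral_gaussianReal_sub (m d : ℝ) (v : ℝ≥0) {f : ℝ → ℝ≥0∞}
    (hf : Measurable f) :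
    ∫⁻ x, f (x - d) ∂(gaussianReal m v) = ∫⁻ x, f x ∂(gaussianReal (m - d) v) := by
  rw [← gaussianReal_map_sub_const d, lintegral_map hf (by fun_prop)]

/-- Overshoots over a positive level are at least as small as those over level zero. -/
theorem overshoot_up (m d : ℝ) (hm : 0 ≤ m) (hd : 0 ≤ d) {v : ℝ≥0} (hv : v ≠ 0) :
    gaussianReal (-m) v (Set.Ioi 0) * gaussianReal m v (Set.Ioi d) ≤
      gaussianReal m v (Set.Ioi 0) *
        ∫⁻ x in Set.Ioi d, ENNReal.ofReal (Real.exp (-(2 * m / v) * (x - d)))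
          ∂(gaussianReal m v) := by
  have hv' : (0 : ℝ) < v := by positivity
  set f : ℝ → ℝ≥0∞ := fun x => ENNReal.ofReal (Real.exp (-(2 * m / v) * x)) with hf
  set w : ℝ → ℝ≥0∞ := fun x => ENNReal.ofReal
    (Real.exp (-(d / v) * x - -(d / v) * m - (-(d / v)) ^ 2 * v / 2)) with hw
  have hfm : Measurable f := by fun_prop
  have hwm : Measurable w := by fun_prop
  -- A translation by `d` is a tilt by `-d/v`, so integrals beyond level `d` become integrals beyond
  -- `0` with the decreasing weight `w`.
  have shift : ∀ g : ℝ → ℝ≥0∞, Measurable g → ∫⁻ x in Set.Ioi d, g (x - d) ∂(gaussianReal m v) =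
      ∫⁻ x in Set.Ioi 0, w x * g x ∂(gaussianReal m v) := by
    intro g hg
    rw [← lintegral_indicator measurableSet_Ioi, ← lintegral_indicator measurableSet_Ioi]
    have h1 : (Set.Ioi d).indicator (fun x => g (x - d)) =
        fun x => (Set.Ioi 0).indicator g (x - d) := by
      ext x; simp [Set.indicator_apply]
    rw [h1, lintegral_gaussianReal_sub m d v (hg.indicator measurableSet_Ioi),
      show m - d = m + -(d / v) * v by field_simp; ring,
      lintegral_gaussianReal_tilt m _ hv (hg.indicator measurableSet_Ioi)]
    refine lintegral_congr fun x => ?_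
    by_cases hx : 0 < x <;> simp [hx, hw]
  have e1 := shift f hfm
  have e2 := shift (fun _ => 1) measurable_const
  -- For `η = -2m/v` the normalising terms cancel, and `f` is exactly the density of `N(-m, v)` with
  -- respect to `N(m, v)`.
  have e3 : ∫⁻ x in Set.Ioi 0, f x ∂(gaussianReal m v) = gaussianReal (-m) v (Set.Ioi 0) := by
    rw [show -m = m + -(2 * m / v) * v by field_simp; ring,
      ← lintegral_indicator_one measurableSet_Ioi,
      lintegral_gaussianReal_tilt m _ hv (measurable_one.indicator measurableSet_Ioi),
      ← lintegral_indicator measurableSet_Ioi]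
    refine lintegral_congr fun x => ?_
    by_cases hx : 0 < x
    · simp only [Set.mem_Ioi, hx, Set.indicator_of_mem, hf, Pi.one_apply, mul_one]
      congr 2
      field_simp
      ring
    · simp [hx]
  simp only [lintegral_const, Measure.restrict_apply MeasurableSet.univ, Set.univ_inter, one_mul,
    mul_one] at e2
  rw [e1, e2, ← e3]
  have hanti : ∀ k : ℝ, 0 ≤ k → ∀ x y : ℝ, x ≤ y → -k * y ≤ -k * x := fun k hk x y hxy => by
    nlinarith
  -- Both `f` and `w` decrease, hence they are positively associated.
  have := lintegral_mul_lintegral_le_of_monovary ((gaussianReal m v).restrict (Set.Ioi 0)) hfm hwm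
    fun x y => by
      have hf' : ∀ x y : ℝ, x ≤ y → f y ≤ f x := fun x y hxy =>
        ENNReal.ofReal_le_ofReal (Real.exp_le_exp.2 (hanti _ (by positivity) x y hxy))
      have hw' : ∀ x y : ℝ, x ≤ y → w y ≤ w x := fun x y hxy =>
        ENNReal.ofReal_le_ofReal (Real.exp_le_exp.2
          (by linarith [hanti (d / v) (by positivity) x y hxy]))
      rcases le_total x y with h | h
      · exact Or.inr ⟨hf' x y h, hw' x y h⟩
      · exact Or.inl ⟨hf' y x h, hw' y x h⟩
  simpa only [Measure.restrict_apply MeasurableSet.univ, Set.univ_inter, mul_comm (w _)] using this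

/-- Overshoots below a negative level are at least as small as those below level zero. -/
theorem overshoot_down (m d : ℝ) (hm : 0 ≤ m) (hd : 0 ≤ d) {v : ℝ≥0} (hv : v ≠ 0) :
    gaussianReal m v (Set.Iio 0) *
        ∫⁻ x in Set.Iio (-d), ENNReal.ofReal (Real.exp (-(2 * m / v) * (x - -d)))
          ∂(gaussianReal m v) ≤
      gaussianReal (-m) v (Set.Iio 0) * gaussianReal m v (Set.Iio (-d)) := by
  have hv' : (0 : ℝ) < v := by positivity
  set f : ℝ → ℝ≥0∞ := fun x => ENNReal.ofReal (Real.exp (-(2 * m / v) * x)) with hf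
  set w : ℝ → ℝ≥0∞ := fun x => ENNReal.ofReal
    (Real.exp ((d / v) * x - (d / v) * m - (d / v) ^ 2 * v / 2)) with hw
  have hfm : Measurable f := by fun_prop
  have hwm : Measurable w := by fun_prop
  have shift : ∀ g : ℝ → ℝ≥0∞, Measurable g →
      ∫⁻ x in Set.Iio (-d), g (x - -d) ∂(gaussianReal m v) =
      ∫⁻ x in Set.Iio 0, w x * g x ∂(gaussianReal m v) := by
    intro g hg
    rw [← lintegral_indicator measurableSet_Iio, ← lintegral_indicator measurableSet_Iio]
    have h1 : (Set.Iio (-d)).indicator (fun x => g (x - -d)) =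
        fun x => (Set.Iio 0).indicator g (x - -d) := by
      ext x
      simp only [Set.indicator_apply, Set.mem_Iio]
      congr 1
      simp only [eq_iff_iff]
      constructor <;> intro h <;> linarith
    rw [h1, lintegral_gaussianReal_sub m (-d) v (hg.indicator measurableSet_Iio),
      show m - -d = m + (d / v) * v by field_simp; ring,
      lintegral_gaussianReal_tilt m _ hv (hg.indicator measurableSet_Iio)]
    refine lintegral_congr fun x => ?_
    by_cases hx : x < 0 <;> simp [hx, hw]
  have e1 := shift f hfm
  have e2 := shift (fun _ => 1) measurable_const
  have e3 : ∫⁻ x in Set.Iio 0, f x ∂(gaussianReal m v) = gaussianReal (-m) v (Set.Iio 0) := by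
    rw [show -m = m + -(2 * m / v) * v by field_simp; ring,
      ← lintegral_indicator_one measurableSet_Iio,
      lintegral_gaussianReal_tilt m _ hv (measurable_one.indicator measurableSet_Iio),
      ← lintegral_indicator measurableSet_Iio]
    refine lintegral_congr fun x => ?_
    by_cases hx : x < 0
    · simp only [Set.mem_Iio, hx, Set.indicator_of_mem, hf, Pi.one_apply, mul_one]
      congr 2
      field_simp
      ring
    · simp [hx]
  simp only [lintegral_const, Measure.restrict_apply MeasurableSet.univ, Set.univ_inter, one_mul,
    mul_one] at e2
  rw [e1, e2, ← e3]
  have hmono : ∀ k : ℝ, 0 ≤ k → ∀ x y : ℝ, x ≤ y → k * x ≤ k * y := fun k hk x y hxy => by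
    nlinarith
  -- At the lower end `w` increases while `f` still decreases, which reverses the inequality.
  have := lintegral_mul_le_of_antivary ((gaussianReal m v).restrict (Set.Iio 0)) hfm hwm
    fun x y => by
      have hf' : ∀ x y : ℝ, x ≤ y → f y ≤ f x := fun x y hxy =>
        ENNReal.ofReal_le_ofReal (Real.exp_le_exp.2
          (by linarith [hmono (2 * m / v) (by positivity) x y hxy]))
      have hw' : ∀ x y : ℝ, x ≤ y → w x ≤ w y := fun x y hxy =>
        ENNReal.ofReal_le_ofReal (Real.exp_le_exp.2
          (by linarith [hmono (d / v) (by positivity) x y hxy]))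
      rcases le_total x y with h | h
      · exact Or.inr ⟨hf' x y h, hw' x y h⟩
      · exact Or.inl ⟨hf' y x h, hw' y x h⟩
  simpa only [Measure.restrict_apply MeasurableSet.univ, Set.univ_inter, mul_comm (w _)] using this

theorem gaussianReal_Iic (m : ℝ) {v : ℝ≥0} (hv : v ≠ 0) (x : ℝ) :
    gaussianReal m v (Set.Iic x) = ENNReal.ofReal (Phi ((x - m) / √v)) := by
  have hs : (0 : ℝ) < √v := Real.sqrt_pos.2 (by positivity)
  have : gaussianReal m v = (gaussianReal 0 1).map (fun y => √v * y + m) := by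
    have h := gaussianReal_map_const_mul (μ := 0) (v := 1) (√v)
    have h2 := gaussianReal_map_add_const (μ := √v * 0) (v := v) m
    rw [show (fun y => √v * y + m) = (fun y => y + m) ∘ (fun y => √(v : ℝ) * y) from rfl,
      ← Measure.map_map (by fun_prop) (by fun_prop), h]
    rw [mul_zero, zero_add] at h2
    rw [mul_zero, ← h2]
    congr 2
    ext
    simp
  rw [this, Measure.map_apply (by fun_prop) measurableSet_Iic, ofReal_Phi]
  congr 1
  ext y
  simp only [Set.mem_preimage, Set.mem_Iic]
  rw [le_div_iff₀ hs]
  constructor <;> intro h <;> linarith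

theorem gaussianReal_Iio (m : ℝ) {v : ℝ≥0} (hv : v ≠ 0) (x : ℝ) :
    gaussianReal m v (Set.Iio x) = ENNReal.ofReal (Phi ((x - m) / √v)) := by
  have := nullSingletonClass_gaussianReal (μ := m) hv
  rw [measure_congr Iio_ae_eq_Iic, gaussianReal_Iic m hv]

theorem gaussianReal_Ioi (m : ℝ) {v : ℝ≥0} (hv : v ≠ 0) (x : ℝ) :
    gaussianReal m v (Set.Ioi x) = ENNReal.ofReal (Phi ((m - x) / √v)) := by
  rw [← Set.compl_Iic, prob_compl_eq_one_sub measurableSet_Iic, gaussianReal_Iic m hv,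
    ← ENNReal.ofReal_one, ← ENNReal.ofReal_sub _ (Phi_pos _).le, ← Phi_neg]
  congr 2
  ring

/-! ### A random walk with normal increments leaving an interval -/

section Walk

variable {Ω : Type*}

/-- The walk `W` stays in `[-c, c]` up to time `t`. -/
def alive (c : ℝ) (W : ℕ → Ω → ℝ) (t : ℕ) : Set Ω := {ω | ∀ s ≤ t, |W s ω| ≤ c}

/-- The walk `W` leaves `[-c, c]` at the upper end, and does so not later than at time `T`. -/
def winBy (c : ℝ) (W : ℕ → Ω → ℝ) (T : ℕ) : Set Ω :=
  {ω | ∃ t ≤ T, c < W t ω ∧ ∀ s < t, |W s ω| ≤ c}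

theorem monotone_winBy (c : ℝ) (W : ℕ → Ω → ℝ) : Monotone (winBy c W) :=
  fun _ _ h _ ⟨t, ht, hω⟩ => ⟨t, ht.trans h, hω⟩

theorem alive_succ (c : ℝ) (W : ℕ → Ω → ℝ) (t : ℕ) :
    alive c W (t + 1) = alive c W t ∩ W (t + 1) ⁻¹' Set.Icc (-c) c := by
  ext ω
  simp only [alive, Set.mem_ofPred_eq, Set.mem_inter_iff, Set.mem_preimage, Set.mem_Icc, ← abs_le]
  exact ⟨fun h => ⟨fun s hs => h s (by omega), h _ le_rfl⟩, fun h s hs => by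
    rcases Nat.lt_or_ge t s with h' | h'
    · rw [show s = t + 1 by omega]; exact h.2
    · exact h.1 s h'⟩

theorem winBy_succ (c : ℝ) (W : ℕ → Ω → ℝ) (t : ℕ) :
    winBy c W (t + 1) = winBy c W t ∪ (alive c W t ∩ W (t + 1) ⁻¹' Set.Ioi c) := by
  ext ω
  constructor
  · rintro ⟨s, hs, h1, h2⟩
    rcases Nat.lt_or_ge t s with h' | h'
    · obtain rfl : s = t + 1 := by omega
      exact Or.inr ⟨fun r hr => h2 r (by omega), h1⟩
    · exact Or.inl ⟨s, h', h1, h2⟩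
  · rintro (⟨s, hs, h⟩ | ⟨h1, h2⟩)
    · exact ⟨s, by omega, h⟩
    · exact ⟨t + 1, le_rfl, h2, fun s hs => h1 s (by omega)⟩

theorem disjoint_winBy_alive (c : ℝ) (W : ℕ → Ω → ℝ) (t : ℕ) :
    Disjoint (winBy c W t) (alive c W t) := by
  rw [Set.disjoint_left]
  rintro ω ⟨s, hs, h1, -⟩ h2
  exact absurd ((le_abs_self _).trans (h2 s hs)) (not_le.2 h1)

variable [MeasurableSpace Ω]

theorem measurableSet_alive {c : ℝ} {W : ℕ → Ω → ℝ} (hW : ∀ t, Measurable (W t)) (t : ℕ) :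
    MeasurableSet (alive c W t) := by
  have : alive c W t = ⋂ s, ⋂ (_ : s ≤ t), {ω | |W s ω| ≤ c} := by ext; simp [alive]
  rw [this]
  exact MeasurableSet.iInter fun s => MeasurableSet.iInter fun _ =>
    measurableSet_le (hW s).abs measurable_const

theorem measurableSet_winBy {c : ℝ} (hc : 0 < c) {W : ℕ → Ω → ℝ} (hW : ∀ t, Measurable (W t))
    (hW0 : ∀ ω, W 0 ω = 0) (T : ℕ) : MeasurableSet (winBy c W T) := by
  induction T with
  | zero =>
    have : winBy c W 0 = ∅ := Set.eq_empty_of_forall_notMem fun ω ⟨t, ht, h, _⟩ => by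
      rw [Nat.le_zero.1 ht, hW0] at h
      linarith
    simp [this]
  | succ T ih =>
    rw [winBy_succ]
    exact ih.union ((measurableSet_alive hW T).inter (hW _ measurableSet_Ioi))

/-- `W` is a random walk started at `0` whose increments have law `κ`; the independence is
required only as far as it is needed for the exit from `[-c, c]`. -/
structure IsWalk (P : Measure Ω) (κ : Measure ℝ) (c : ℝ) (W : ℕ → Ω → ℝ) : Prop where
  measurable : ∀ t, Measurable (W t)
  zero : ∀ ω, W 0 ω = 0
  law : ∀ t, P.map (fun ω => W (t + 1) ω - W t ω) = κ
  indep : ∀ t, IndepFun (fun ω => (W t ω, (alive c W t).indicator (fun _ => (1 : ℝ≥0∞)) ω))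
    (fun ω => W (t + 1) ω - W t ω) P

variable {P : Measure Ω} {κ : Measure ℝ} {c : ℝ} {W : ℕ → Ω → ℝ}

theorem IsWalk.lintegral_split (h : IsWalk P κ c W) (hc : 0 < c) (t : ℕ) {f : ℝ → ℝ≥0∞}
    (hf : Measurable f) :
    ∫⁻ ω in alive c W t, f (W (t + 1) ω) ∂P =
      (∫⁻ ω in alive c W (t + 1), f (W (t + 1) ω) ∂P) +
      (∫⁻ ω in alive c W t ∩ W (t + 1) ⁻¹' Set.Ioi c, f (W (t + 1) ω) ∂P) +
      (∫⁻ ω in alive c W t ∩ W (t + 1) ⁻¹' Set.Iio (-c), f (W (t + 1) ω) ∂P) := by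
  have hE := measurableSet_alive (c := c) h.measurable t
  have hm := h.measurable (t + 1)
  rw [alive_succ, ← lintegral_indicator hE, ← lintegral_indicator (hE.inter (hm measurableSet_Icc)),
    ← lintegral_indicator (hE.inter (hm measurableSet_Ioi)),
    ← lintegral_indicator (hE.inter (hm measurableSet_Iio)), ← lintegral_add_left,
    ← lintegral_add_left]
  · refine lintegral_congr fun ω => ?_
    by_cases hω : ω ∈ alive c W t
    · rcases lt_or_ge (W (t + 1) ω) (-c) with h1 | h1
      · have h2 : ¬ c < W (t + 1) ω := by linarith
        simp [hω, h1, h2, not_le.2 h1]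
      · rcases lt_or_ge c (W (t + 1) ω) with h2 | h2
        · simp [hω, not_lt.2 h1, h2, not_le.2 h2]
        · simp [hω, not_lt.2 h1, not_lt.2 h2, h1, h2]
    · simp [hω]
  · exact ((hf.comp hm).indicator (hE.inter (hm measurableSet_Icc))).add
      ((hf.comp hm).indicator (hE.inter (hm measurableSet_Ioi)))
  · exact (hf.comp hm).indicator (hE.inter (hm measurableSet_Icc))

theorem IsWalk.measure_winBy (h : IsWalk P κ c W) (hc : 0 < c) (T : ℕ) :
    P (winBy c W T) = ∑ t ∈ Finset.range T, P (alive c W t ∩ W (t + 1) ⁻¹' Set.Ioi c) := by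
  induction T with
  | zero =>
    have : winBy c W 0 = ∅ := Set.eq_empty_of_forall_notMem fun ω ⟨t, ht, h', _⟩ => by
      rw [Nat.le_zero.1 ht, h.zero] at h'
      linarith
    simp [this]
  | succ T ih =>
    rw [winBy_succ, measure_union ((disjoint_winBy_alive c W T).mono_right Set.inter_subset_left)
      ((measurableSet_alive h.measurable T).inter (h.measurable _ measurableSet_Ioi)), ih,
      Finset.sum_range_succ]

variable [IsProbabilityMeasure P] [IsProbabilityMeasure κ]

/-- The Markov property at a fixed time: the next increment is independent of the position together
with the survival indicator. -/
theorem IsWalk.lintegral_succ (h : IsWalk P κ c W) (t : ℕ) {f : ℝ → ℝ≥0∞} (hf : Measurable f) :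
    ∫⁻ ω in alive c W t, f (W (t + 1) ω) ∂P =
      ∫⁻ ω in alive c W t, (∫⁻ x, f (W t ω + x) ∂κ) ∂P := by
  have hE := measurableSet_alive (c := c) h.measurable t
  have hm := h.measurable
  have hφ : Measurable fun ω => (W t ω, (alive c W t).indicator (fun _ => (1 : ℝ≥0∞)) ω) :=
    (hm t).prodMk (measurable_const.indicator hE)
  have hX : Measurable fun ω => W (t + 1) ω - W t ω := (hm _).sub (hm _)
  have hprod := (indepFun_iff_map_prod_eq_prod_map_map hφ.aemeasurable hX.aemeasurable).1
    (h.indep t)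
  rw [h.law] at hprod
  set F : (ℝ × ℝ≥0∞) × ℝ → ℝ≥0∞ := fun z => z.1.2 * f (z.1.1 + z.2) with hF
  have hFm : Measurable F := by fun_prop
  have h1 := lintegral_map (μ := P) hFm (hφ.prodMk hX)
  rw [hprod, lintegral_prod _ hFm.aemeasurable, lintegral_map hFm.lintegral_prod_right' hφ] at h1
  rw [← lintegral_indicator hE, ← lintegral_indicator hE]
  refine Eq.trans ?_ (h1.symm.trans ?_) <;> refine lintegral_congr fun ω => ?_
  · by_cases hω : ω ∈ alive c W t <;> simp [hF, hω]
  · by_cases hω : ω ∈ alive c W t <;> simp [hF, hω]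

theorem IsWalk.measure_inter (h : IsWalk P κ c W) (t : ℕ) {s : Set ℝ} (hs : MeasurableSet s) :
    P (alive c W t ∩ W (t + 1) ⁻¹' s) =
      ∫⁻ ω in alive c W t, κ {x | W t ω + x ∈ s} ∂P := by
  have hE := measurableSet_alive (c := c) h.measurable t
  have := h.lintegral_succ t (measurable_one.indicator hs)
  have e1 : ∀ ω, s.indicator (1 : ℝ → ℝ≥0∞) (W (t + 1) ω) = (W (t + 1) ⁻¹' s).indicator 1 ω :=
    fun ω => rfl
  simp_rw [e1] at this
  rw [lintegral_indicator_one (h.measurable _ hs), Measure.restrict_apply (h.measurable _ hs),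
    Set.inter_comm] at this
  rw [this]
  refine lintegral_congr fun ω => ?_
  rw [← lintegral_indicator_one
    (show MeasurableSet {x | W t ω + x ∈ s} from hs.preimage (measurable_const_add _))]
  rfl

/-- Optional stopping at the minimum of `T` and the exit time, for a function `f` that is harmonic
for the walk. The final mass is split into survival, upper exit and lower exit. -/
theorem IsWalk.telescope (h : IsWalk P κ c W) (hc : 0 < c) {f : ℝ → ℝ≥0∞} (hf : Measurable f)
    (hmart : ∀ w, ∫⁻ x, f (w + x) ∂κ = f w) (T : ℕ) :
    f 0 = (∫⁻ ω in alive c W T, f (W T ω) ∂P) +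
      (∑ t ∈ Finset.range T,
        ∫⁻ ω in alive c W t ∩ W (t + 1) ⁻¹' Set.Ioi c, f (W (t + 1) ω) ∂P) +
      (∑ t ∈ Finset.range T,
        ∫⁻ ω in alive c W t ∩ W (t + 1) ⁻¹' Set.Iio (-c), f (W (t + 1) ω) ∂P) := by
  induction T with
  | zero =>
    have : alive c W 0 = Set.univ := Set.eq_univ_of_forall fun ω s hs => by
      rw [Nat.le_zero.1 hs, h.zero, abs_zero]; exact hc.le
    simp [this, h.zero]
  | succ T ih =>
    have e : ∫⁻ ω in alive c W T, f (W T ω) ∂P = ∫⁻ ω in alive c W T, f (W (T + 1) ω) ∂P := by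
      rw [h.lintegral_succ T hf]
      simp_rw [hmart]
    rw [e, h.lintegral_split hc T hf] at ih
    rw [ih, Finset.sum_range_succ, Finset.sum_range_succ]
    ring

theorem IsWalk.measure_telescope (h : IsWalk P κ c W) (hc : 0 < c) (T : ℕ) :
    1 = P (alive c W T) + P (winBy c W T) +
      ∑ t ∈ Finset.range T, P (alive c W t ∩ W (t + 1) ⁻¹' Set.Iio (-c)) := by
  have := h.telescope hc (f := fun _ => 1) measurable_const (by simp) T
  rw [h.measure_winBy hc]
  simpa using this

/-- A surviving walk sits at or above `-c`, so an increment larger than `2c` would end the game;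
survival is thus geometrically unlikely. -/
theorem IsWalk.measure_alive_le (h : IsWalk P κ c W) (T : ℕ) :
    P (alive c W T) ≤ κ (Set.Iic (2 * c)) ^ T := by
  induction T with
  | zero => simpa using prob_le_one
  | succ T ih =>
    rw [alive_succ, h.measure_inter T measurableSet_Icc, pow_succ, mul_comm]
    refine le_trans ?_ (mul_le_mul_right ih _)
    rw [← setLIntegral_const]
    refine setLIntegral_mono' (measurableSet_alive h.measurable T) fun ω hω => ?_
    refine measure_mono fun x hx => ?_
    have := (abs_le.1 (hω T le_rfl)).1
    exact Set.mem_Iic.2 (by linarith [hx.2])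

end Walk

/-! ### Exit probabilities of the normal walk -/

section NormalWalk

variable {Ω : Type*} [MeasurableSpace Ω] {P : Measure Ω} [IsProbabilityMeasure P]
  {c m : ℝ} {v : ℝ≥0} {W : ℕ → Ω → ℝ}

/-- The rate `-2m/v` is chosen so that the moment generating function `exp(ηm + η²v/2)` equals one
there. -/
theorem lintegral_exp_gaussianReal (m : ℝ) {v : ℝ≥0} (hv : v ≠ 0) (w : ℝ) :
    ∫⁻ x, ENNReal.ofReal (Real.exp (-(2 * m / v) * (w + x))) ∂(gaussianReal m v) =
      ENNReal.ofReal (Real.exp (-(2 * m / v) * w)) := by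
  have hv' : (v : ℝ) ≠ 0 := by exact_mod_cast hv
  have := lintegral_gaussianReal_tilt m (-(2 * m / v)) hv (f := fun _ => 1) measurable_const
  simp only [lintegral_const, measure_univ, mul_one] at this
  simp_rw [mul_add, Real.exp_add, ENNReal.ofReal_mul (Real.exp_pos _).le]
  rw [lintegral_const_mul _ (by fun_prop)]
  conv_rhs => rw [← mul_one (ENNReal.ofReal _), this]
  congr 1
  refine lintegral_congr fun x => ?_
  congr 2
  field_simp
  ring

/-- Conditionally on `W t`, this is the overshoot bound at distance `d = c - W t ≥ 0`. The ratio
`R(-m/√v)` appears cross-multiplied, as the two normal probabilities. -/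
theorem IsWalk.up_le (h : IsWalk P (gaussianReal m v) c W) (hv : v ≠ 0) (hm : 0 ≤ m) (t : ℕ) :
    gaussianReal (-m) v (Set.Ioi 0) * (ENNReal.ofReal (Real.exp (-(2 * m / v) * c)) *
        P (alive c W t ∩ W (t + 1) ⁻¹' Set.Ioi c)) ≤
      gaussianReal m v (Set.Ioi 0) * ∫⁻ ω in alive c W t ∩ W (t + 1) ⁻¹' Set.Ioi c,
        ENNReal.ofReal (Real.exp (-(2 * m / v) * W (t + 1) ω)) ∂P := by
  have hE := measurableSet_alive (c := c) h.measurable t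
  set f : ℝ → ℝ≥0∞ := fun x => ENNReal.ofReal (Real.exp (-(2 * m / v) * x)) with hf
  have hfm : Measurable f := by fun_prop
  have e1 : ∫⁻ ω in alive c W t ∩ W (t + 1) ⁻¹' Set.Ioi c, f (W (t + 1) ω) ∂P =
      ∫⁻ ω in alive c W t, (Set.Ioi c).indicator f (W (t + 1) ω) ∂P := by
    rw [Set.inter_comm, ← Measure.restrict_restrict (h.measurable _ measurableSet_Ioi),
      ← lintegral_indicator (h.measurable _ measurableSet_Ioi)]
    rfl
  rw [e1, h.lintegral_succ t (hfm.indicator measurableSet_Ioi), h.measure_inter t measurableSet_Ioi,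
    ← lintegral_const_mul' _ _ (by simp), ← lintegral_const_mul' _ _ (measure_ne_top _ _),
    ← lintegral_const_mul' _ _ (measure_ne_top _ _)]
  refine setLIntegral_mono' hE fun ω hω => ?_
  have hd : 0 ≤ c - W t ω := by linarith [(abs_le.1 (hω t le_rfl)).2]
  have key := overshoot_up m _ hm hd hv
  have e2 : {x | W t ω + x ∈ Set.Ioi c} = Set.Ioi (c - W t ω) := by
    ext x; simp [sub_lt_iff_lt_add']
  have e3 : ∫⁻ x, (Set.Ioi c).indicator f (W t ω + x) ∂(gaussianReal m v) =
      f c * ∫⁻ x in Set.Ioi (c - W t ω),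
        ENNReal.ofReal (Real.exp (-(2 * m / v) * (x - (c - W t ω)))) ∂(gaussianReal m v) := by
    rw [← lintegral_const_mul _ (by fun_prop), ← lintegral_indicator measurableSet_Ioi]
    refine lintegral_congr fun x => ?_
    by_cases hx : c < W t ω + x
    · rw [Set.indicator_of_mem (Set.mem_Ioi.2 hx),
        Set.indicator_of_mem (Set.mem_Ioi.2 (by linarith))]
      simp only [hf]
      rw [← ENNReal.ofReal_mul (Real.exp_pos _).le, ← Real.exp_add]
      congr 2
      ring
    · rw [Set.indicator_of_notMem (by simpa using hx),
        Set.indicator_of_notMem (by simpa [sub_lt_iff_lt_add'] using hx)]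
  rw [e2, e3, mul_left_comm, mul_left_comm _ (f c)]
  exact mul_le_mul_right key _

theorem IsWalk.down_le (h : IsWalk P (gaussianReal m v) c W) (hv : v ≠ 0) (hm : 0 ≤ m) (t : ℕ) :
    gaussianReal m v (Set.Iio 0) * ∫⁻ ω in alive c W t ∩ W (t + 1) ⁻¹' Set.Iio (-c),
        ENNReal.ofReal (Real.exp (-(2 * m / v) * W (t + 1) ω)) ∂P ≤
      gaussianReal (-m) v (Set.Iio 0) * (ENNReal.ofReal (Real.exp (-(2 * m / v) * -c)) *
        P (alive c W t ∩ W (t + 1) ⁻¹' Set.Iio (-c))) := by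
  have hE := measurableSet_alive (c := c) h.measurable t
  set f : ℝ → ℝ≥0∞ := fun x => ENNReal.ofReal (Real.exp (-(2 * m / v) * x)) with hf
  have hfm : Measurable f := by fun_prop
  have e1 : ∫⁻ ω in alive c W t ∩ W (t + 1) ⁻¹' Set.Iio (-c), f (W (t + 1) ω) ∂P =
      ∫⁻ ω in alive c W t, (Set.Iio (-c)).indicator f (W (t + 1) ω) ∂P := by
    rw [Set.inter_comm, ← Measure.restrict_restrict (h.measurable _ measurableSet_Iio),
      ← lintegral_indicator (h.measurable _ measurableSet_Iio)]
    rfl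
  rw [e1, h.lintegral_succ t (hfm.indicator measurableSet_Iio), h.measure_inter t measurableSet_Iio,
    ← lintegral_const_mul' (ENNReal.ofReal _) _ (by simp),
    ← lintegral_const_mul' _ _ (measure_ne_top _ _),
    ← lintegral_const_mul' _ _ (measure_ne_top _ _)]
  refine setLIntegral_mono' hE fun ω hω => ?_
  have hd : 0 ≤ c + W t ω := by linarith [(abs_le.1 (hω t le_rfl)).1]
  have key := overshoot_down m _ hm hd hv
  have e2 : {x | W t ω + x ∈ Set.Iio (-c)} = Set.Iio (-(c + W t ω)) := by
    ext x
    simp only [Set.mem_Iio, Set.mem_ofPred_eq]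
    constructor <;> intro h <;> linarith
  have e3 : ∫⁻ x, (Set.Iio (-c)).indicator f (W t ω + x) ∂(gaussianReal m v) =
      f (-c) * ∫⁻ x in Set.Iio (-(c + W t ω)),
        ENNReal.ofReal (Real.exp (-(2 * m / v) * (x - -(c + W t ω)))) ∂(gaussianReal m v) := by
    rw [← lintegral_const_mul _ (by fun_prop), ← lintegral_indicator measurableSet_Iio]
    refine lintegral_congr fun x => ?_
    by_cases hx : W t ω + x < -c
    · rw [Set.indicator_of_mem (Set.mem_Iio.2 hx),
        Set.indicator_of_mem (Set.mem_Iio.2 (by linarith))]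
      simp only [hf]
      rw [← ENNReal.ofReal_mul (Real.exp_pos _).le, ← Real.exp_add]
      congr 2
      ring
    · rw [Set.indicator_of_notMem (by simpa using hx),
        Set.indicator_of_notMem (by simp only [Set.mem_Iio]; intro h; exact hx (by linarith))]
  rw [e2, e3, mul_left_comm, mul_left_comm _ (f (-c))]
  exact mul_le_mul_right key _

theorem exp_mul_anti (hm : 0 ≤ m) (v : ℝ≥0) {x y : ℝ} (h : x ≤ y) :
    ENNReal.ofReal (Real.exp (-(2 * m / v) * y)) ≤ ENNReal.ofReal (Real.exp (-(2 * m / v) * x)) := by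
  refine ENNReal.ofReal_le_ofReal (Real.exp_le_exp.2 ?_)
  have : 0 ≤ 2 * m / v := by positivity
  nlinarith

/-- Upper bound for the probability of an exit at the upper end, before division. -/
theorem IsWalk.winBy_upper (h : IsWalk P (gaussianReal m v) c W) (hc : 0 < c) (hv : v ≠ 0)
    (hm : 0 ≤ m) (T : ℕ) :
    gaussianReal m v (Set.Iio 0) ≤
      gaussianReal m v (Set.Iio 0) *
        (ENNReal.ofReal (Real.exp (-(2 * m / v) * -c)) * P (alive c W T)) +
      gaussianReal m v (Set.Iio 0) *
        (ENNReal.ofReal (Real.exp (-(2 * m / v) * c)) * P (winBy c W T)) +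
      gaussianReal (-m) v (Set.Iio 0) * (ENNReal.ofReal (Real.exp (-(2 * m / v) * -c)) *
        ∑ t ∈ Finset.range T, P (alive c W t ∩ W (t + 1) ⁻¹' Set.Iio (-c))) := by
  have hE := fun t => measurableSet_alive (c := c) h.measurable t
  have tel := h.telescope hc (f := fun x => ENNReal.ofReal (Real.exp (-(2 * m / v) * x)))
    (by fun_prop) (lintegral_exp_gaussianReal m hv) T
  simp only [mul_zero, Real.exp_zero, ENNReal.ofReal_one] at tel
  conv_lhs => rw [← mul_one (gaussianReal m v (Set.Iio 0)), tel, mul_add, mul_add]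
  refine add_le_add (add_le_add (mul_le_mul_right ?_ _) (mul_le_mul_right ?_ _)) ?_
  · rw [← setLIntegral_const]
    exact setLIntegral_mono' (hE T) fun ω hω => exp_mul_anti hm v (abs_le.1 (hω T le_rfl)).1
  · rw [h.measure_winBy hc, Finset.mul_sum]
    refine Finset.sum_le_sum fun t _ => ?_
    rw [← setLIntegral_const]
    exact setLIntegral_mono' ((hE t).inter (h.measurable _ measurableSet_Ioi))
      fun ω hω => exp_mul_anti hm v hω.2.le
  · rw [Finset.mul_sum, Finset.mul_sum, Finset.mul_sum]
    exact Finset.sum_le_sum fun t _ => h.down_le hv hm t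

/-- Lower bound for the probability of an exit at the upper end, before division. -/
theorem IsWalk.winBy_lower (h : IsWalk P (gaussianReal m v) c W) (hc : 0 < c) (hv : v ≠ 0)
    (hm : 0 ≤ m) (T : ℕ) :
    gaussianReal (-m) v (Set.Ioi 0) *
        (ENNReal.ofReal (Real.exp (-(2 * m / v) * c)) * P (winBy c W T)) +
      gaussianReal m v (Set.Ioi 0) * (ENNReal.ofReal (Real.exp (-(2 * m / v) * -c)) *
        ∑ t ∈ Finset.range T, P (alive c W t ∩ W (t + 1) ⁻¹' Set.Iio (-c))) ≤
    gaussianReal m v (Set.Ioi 0) := by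
  have hE := fun t => measurableSet_alive (c := c) h.measurable t
  have tel := h.telescope hc (f := fun x => ENNReal.ofReal (Real.exp (-(2 * m / v) * x)))
    (by fun_prop) (lintegral_exp_gaussianReal m hv) T
  simp only [mul_zero, Real.exp_zero, ENNReal.ofReal_one] at tel
  conv_rhs => rw [← mul_one (gaussianReal m v (Set.Ioi 0)), tel, mul_add, mul_add]
  refine add_le_add ?_ (mul_le_mul_right ?_ _)
  · refine le_trans ?_ le_add_self
    rw [h.measure_winBy hc, Finset.mul_sum, Finset.mul_sum, Finset.mul_sum]
    exact Finset.sum_le_sum fun t _ => h.up_le hv hm t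
  · rw [Finset.mul_sum]
    refine Finset.sum_le_sum fun t _ => ?_
    rw [← setLIntegral_const]
    exact setLIntegral_mono' ((hE t).inter (h.measurable _ measurableSet_Iio))
      fun ω hω => exp_mul_anti hm v hω.2.le

theorem R_neg_lt_one {a : ℝ} (ha : 0 < a) : R (-a) < 1 := by
  have := Phi_neg a
  rw [R, div_lt_one (by linarith [Phi_lt_one (-a)])]
  have := strictMono_Phi (show -a < a by linarith)
  linarith

theorem one_lt_R {a : ℝ} (ha : 0 < a) : 1 < R a := by
  have := Phi_neg a
  rw [R, one_lt_div (by linarith [Phi_lt_one a])]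
  have := strictMono_Phi (show -a < a by linarith)
  linarith

/-- Both gambler's ruin bounds at a finite horizon and free of division. The lower exit probability
is eliminated through total mass one. -/
theorem IsWalk.real_bounds (h : IsWalk P (gaussianReal m v) c W) (hc : 0 < c) (hv : v ≠ 0)
    (hm : 0 < m) (T : ℕ) :
    P.real (winBy c W T) *
        (Real.exp (2 * m / v * c) * R (m / √v) - Real.exp (-(2 * m / v * c))) ≤
      Real.exp (2 * m / v * c) * R (m / √v) - 1 ∧
    Real.exp (2 * m / v * c) * (1 - P.real (alive c W T)) - 1 ≤ P.real (winBy c W T) *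
      (Real.exp (2 * m / v * c) - R (-(m / √v)) * Real.exp (-(2 * m / v * c))) := by
  have hs : (0 : ℝ) < √v := Real.sqrt_pos.2 (by positivity)
  set p := P.real (winBy c W T) with hp
  set e := P.real (alive c W T) with he
  set d := (∑ t ∈ Finset.range T, P (alive c W t ∩ W (t + 1) ⁻¹' Set.Iio (-c))).toReal with hd
  have hdfin : ∑ t ∈ Finset.range T, P (alive c W t ∩ W (t + 1) ⁻¹' Set.Iio (-c)) =
      ENNReal.ofReal d :=
    (ENNReal.ofReal_toReal (ENNReal.sum_ne_top.2 fun _ _ => measure_ne_top _ _)).symm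
  have hpfin : P (winBy c W T) = ENNReal.ofReal p := (ofReal_measureReal).symm
  have hefin : P (alive c W T) = ENNReal.ofReal e := (ofReal_measureReal).symm
  have hp0 : 0 ≤ p := measureReal_nonneg
  have he0 : 0 ≤ e := measureReal_nonneg
  have hd0 : 0 ≤ d := ENNReal.toReal_nonneg
  have h1 := h.measure_telescope hc T
  have h2 := h.winBy_upper hc hv hm.le T
  have h3 := h.winBy_lower hc hv hm.le T
  rw [hdfin, hpfin, hefin, ← ENNReal.ofReal_add he0 hp0, ← ENNReal.ofReal_add (by positivity) hd0,
    ← ENNReal.ofReal_one] at h1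
  have h1' : 1 = e + p + d := by
    rwa [ENNReal.ofReal_eq_ofReal_iff (by norm_num) (by positivity)] at h1
  have hΦ := Phi_pos (m / √v)
  have hΦ' := Phi_pos (-(m / √v))
  rw [hdfin, hpfin, hefin, gaussianReal_Iio _ hv, gaussianReal_Iio _ hv,
    ← ENNReal.ofReal_mul (Real.exp_pos _).le, ← ENNReal.ofReal_mul (Real.exp_pos _).le,
    ← ENNReal.ofReal_mul (Real.exp_pos _).le, ← ENNReal.ofReal_mul (Phi_pos _).le,
    ← ENNReal.ofReal_mul (Phi_pos _).le, ← ENNReal.ofReal_mul (Phi_pos _).le,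
    ← ENNReal.ofReal_add (by have := Phi_pos ((0 - m) / √v); positivity)
      (by have := Phi_pos ((0 - m) / √v); positivity),
    ← ENNReal.ofReal_add (by have := Phi_pos ((0 - m) / √v); positivity)
      (by have := Phi_pos ((0 - -m) / √v); positivity), ENNReal.ofReal_le_ofReal_iff
      (by have := Phi_pos ((0 - m) / √v); have := Phi_pos ((0 - -m) / √v); positivity)] at h2
  rw [hdfin, hpfin, gaussianReal_Ioi _ hv, gaussianReal_Ioi _ hv,
    ← ENNReal.ofReal_mul (Real.exp_pos _).le, ← ENNReal.ofReal_mul (Real.exp_pos _).le,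
    ← ENNReal.ofReal_mul (Phi_pos _).le, ← ENNReal.ofReal_mul (Phi_pos _).le,
    ← ENNReal.ofReal_add (by have := Phi_pos ((-m - 0) / √v); positivity)
      (by have := Phi_pos ((m - 0) / √v); positivity),
    ENNReal.ofReal_le_ofReal_iff (Phi_pos _).le] at h3
  rw [show (0 - m) / √(v : ℝ) = -(m / √v) by ring, show (0 - -m) / √(v : ℝ) = m / √v by ring,
    show -(2 * m / v) * -c = 2 * m / v * c by ring,
    show -(2 * m / v) * c = -(2 * m / v * c) by ring] at h2
  rw [show (-m - 0) / √(v : ℝ) = -(m / √v) by ring, show (m - 0) / √(v : ℝ) = m / √v by ring,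
    show -(2 * m / v) * -c = 2 * m / v * c by ring,
    show -(2 * m / v) * c = -(2 * m / v * c) by ring] at h3
  have hR1 : Phi (m / √v) = R (m / √v) * Phi (-(m / √v)) := by
    rw [R, Phi_neg, div_mul_cancel₀]; linarith [Phi_lt_one (m / √v)]
  have hR2 : Phi (-(m / √v)) = R (-(m / √v)) * Phi (m / √v) := by
    rw [R, ← Phi_neg, neg_neg, div_mul_cancel₀ _ hΦ.ne']
  have hR := one_lt_R (div_pos hm hs)
  set C := Real.exp (2 * m / v * c)
  set D := Real.exp (-(2 * m / v * c))
  constructor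
  · rw [hR1] at h2
    have h4 : 1 ≤ C * e + D * p + R (m / √v) * (C * d) := by
      refine le_of_mul_le_mul_left ?_ hΦ'
      linarith
    -- Since `R ≥ 1`, surviving paths may be charged like lower exits, so the upper bound needs no
    -- limit in `T`.
    have : C * e ≤ R (m / √v) * (C * e) :=
      le_mul_of_one_le_left (mul_nonneg (Real.exp_pos _).le he0) hR.le
    have hd' : d = 1 - e - p := by linarith
    rw [hd'] at h4
    nlinarith
  · rw [hR2] at h3
    have h4 : R (-(m / √v)) * (D * p) + C * d ≤ 1 := by
      refine le_of_mul_le_mul_left ?_ hΦ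
      linarith
    have hd' : d = 1 - e - p := by linarith
    rw [hd'] at h4
    nlinarith

/-- The gambler's ruin probability of a random walk with normal increments. -/
theorem IsWalk.bounds {σ : ℝ≥0} (hσ : 0 < σ) (h : IsWalk P (gaussianReal m (2 * σ ^ 2)) c W)
    (hc : 0 < c) (hm : 0 < m) :
    ENNReal.ofReal (LB c σ m) ≤ P (⋃ T, winBy c W T) ∧
    P (⋃ T, winBy c W T) ≤ ENNReal.ofReal (UB c σ m) := by
  have hv : (2 * σ ^ 2 : ℝ≥0) ≠ 0 := by positivity
  have hσ' : (0 : ℝ) < σ := hσ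
  have hs : √((2 * σ ^ 2 : ℝ≥0) : ℝ) = σ * √2 := by
    push_cast
    rw [mul_comm, Real.sqrt_mul (by positivity), Real.sqrt_sq hσ'.le]
  have hexp : 2 * m / ((2 * σ ^ 2 : ℝ≥0) : ℝ) * c = m * c / σ ^ 2 := by
    push_cast; field_simp
  have hb := h.real_bounds hc hv hm
  rw [hs, hexp] at hb
  have ha : 0 < m / (σ * √2) := by positivity
  have hC : 1 < Real.exp (m * c / σ ^ 2) := Real.one_lt_exp_iff.2 (by positivity)
  have hD : 0 < Real.exp (-(m * c / σ ^ 2)) := Real.exp_pos _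
  have hD1 : Real.exp (-(m * c / σ ^ 2)) < 1 := by
    rw [Real.exp_neg]; exact inv_lt_one_of_one_lt₀ hC
  have hL := R_neg_lt_one ha
  have hU := one_lt_R ha
  have hlim : Filter.Tendsto (fun T => P (winBy c W T)) Filter.atTop
      (nhds (P (⋃ T, winBy c W T))) := tendsto_measure_iUnion_atTop (monotone_winBy c W)
  constructor
  · have hal : Filter.Tendsto (fun T => P.real (alive c W T)) Filter.atTop (nhds 0) := by
      have : gaussianReal m (2 * σ ^ 2) (Set.Iic (2 * c)) < 1 := by
        rw [gaussianReal_Iic m hv, ENNReal.ofReal_lt_one]; exact Phi_lt_one _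
      have := tendsto_of_tendsto_of_tendsto_of_le_of_le tendsto_const_nhds
        (ENNReal.tendsto_pow_atTop_nhds_zero_of_lt_one this) (fun _ => zero_le)
        h.measure_alive_le
      exact (ENNReal.tendsto_toReal (by simp)).comp this
    have hlim' := (ENNReal.tendsto_toReal (measure_ne_top P _)).comp hlim
    have := le_of_tendsto_of_tendsto' ((((tendsto_const_nhds (x := (1 : ℝ))).sub hal).const_mul
      (Real.exp (m * c / σ ^ 2))).sub_const 1)
      (hlim'.mul_const _) fun T => (hb T).2
    rw [ENNReal.ofReal_le_iff_le_toReal (measure_ne_top _ _), LB]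
    rw [div_le_iff₀ (by nlinarith)]
    linarith
  · refine le_of_tendsto' hlim fun T => ?_
    rw [← ofReal_measureReal]
    refine ENNReal.ofReal_le_ofReal ?_
    rw [UB, le_div_iff₀ (by nlinarith)]
    exact (hb T).1

end NormalWalk

/-! ### The gambler's ruin games between the arms, for fixed means -/

section Table

variable {n : ℕ}

/-- The difference of the sums of two arms after `t` rounds, as a function of the table. -/
def sumDiff (i j : Fin n) (t : ℕ) (x : Fin n × ℕ → ℝ) : ℝ :=
  partialSum (fun k s => x (k, s)) i t - partialSum (fun k s => x (k, s)) j t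

/-- The tables of observations for which arm `i` beats every other arm. -/
def beatsAllSet (c : ℝ) (i : Fin n) : Set (Fin n × ℕ → ℝ) :=
  {x | ∀ j, j ≠ i → Beats c (fun k s => x (k, s)) i j}

/-- The law of the observations when the means are `m`. -/
noncomputable def tableLaw (σ : ℝ≥0) (m : Fin n → ℝ) : Measure (Fin n × ℕ → ℝ) :=
  Measure.infinitePi fun p : Fin n × ℕ => gaussianReal (m p.1) (σ ^ 2)

instance (σ : ℝ≥0) (m : Fin n → ℝ) : IsProbabilityMeasure (tableLaw σ m) := by
  unfold tableLaw; infer_instance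

theorem measurable_sumDiff (i j : Fin n) (t : ℕ) : Measurable (sumDiff i j t) := by
  unfold sumDiff partialSum; fun_prop

theorem sumDiff_zero (i j : Fin n) (x : Fin n × ℕ → ℝ) : sumDiff i j 0 x = 0 := by
  simp [sumDiff, partialSum]

theorem sumDiff_succ (i j : Fin n) (t : ℕ) (x : Fin n × ℕ → ℝ) :
    sumDiff i j (t + 1) x - sumDiff i j t x = x (i, t) - x (j, t) := by
  simp [sumDiff, partialSum, Finset.sum_range_succ]; ring

theorem sumDiff_congr (i j : Fin n) {t s : ℕ} (hs : s ≤ t) {x y : Fin n × ℕ → ℝ}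
    (h : ∀ p ∈ Finset.univ ×ˢ Finset.range t, x p = y p) : sumDiff i j s x = sumDiff i j s y := by
  have : ∀ k r, r < s → x (k, r) = y (k, r) := fun k r hr => h _ (by simp; omega)
  unfold sumDiff partialSum
  congr 1 <;> exact Finset.sum_congr rfl fun r hr => this _ r (Finset.mem_range.1 hr)

theorem alive_sumDiff_congr (c : ℝ) (i j : Fin n) {t : ℕ} {x y : Fin n × ℕ → ℝ}
    (h : ∀ p ∈ Finset.univ ×ˢ Finset.range t, x p = y p) :
    x ∈ alive c (sumDiff i j) t ↔ y ∈ alive c (sumDiff i j) t := by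
  simp only [alive, Set.mem_ofPred_eq]
  exact forall₂_congr fun s hs => by rw [sumDiff_congr i j hs h]

theorem winBy_sumDiff_congr (c : ℝ) (i j : Fin n) {t : ℕ} {x y : Fin n × ℕ → ℝ}
    (h : ∀ p ∈ Finset.univ ×ˢ Finset.range t, x p = y p) :
    x ∈ winBy c (sumDiff i j) t ↔ y ∈ winBy c (sumDiff i j) t := by
  simp only [winBy, Set.mem_ofPred_eq]
  refine exists_congr fun s => and_congr_right fun hs => ?_
  rw [sumDiff_congr i j hs h]
  exact and_congr_right fun _ => forall₂_congr fun r hr => by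
    rw [sumDiff_congr i j (hr.le.trans hs) h]

theorem map_eval_tableLaw (σ : ℝ≥0) (m : Fin n → ℝ) (p : Fin n × ℕ) :
    (tableLaw σ m).map (fun x => x p) = gaussianReal (m p.1) (σ ^ 2) :=
  Measure.infinitePi_map_eval _ p

theorem iIndepFun_tableLaw (σ : ℝ≥0) (m : Fin n → ℝ) :
    iIndepFun (fun (p : Fin n × ℕ) (x : Fin n × ℕ → ℝ) => x p) (tableLaw σ m) :=
  iIndepFun_infinitePi (P := fun p : Fin n × ℕ => gaussianReal (m p.1) (σ ^ 2))
    (X := fun _ x => x) fun _ => measurable_id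

theorem isWalk_sumDiff (σ : ℝ≥0) (m : Fin n → ℝ) (c : ℝ) {i j : Fin n} (hij : i ≠ j) :
    IsWalk (tableLaw σ m) (gaussianReal (m i - m j) (2 * σ ^ 2)) c (sumDiff i j) where
  measurable := measurable_sumDiff i j
  zero := sumDiff_zero i j
  law t := by
    simp_rw [sumDiff_succ, sub_eq_add_neg]
    have hind := (iIndepFun_tableLaw σ m).indepFun (i := (i, t)) (j := (j, t)) (by simp [hij])
    have hneg : (tableLaw σ m).map (fun x => -x (j, t)) = gaussianReal (-m j) (σ ^ 2) := by
      rw [← gaussianReal_map_neg, ← map_eval_tableLaw σ m (j, t),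
        Measure.map_map (g := fun x : ℝ => -x) (f := fun x : Fin n × ℕ → ℝ => x (j, t))
          (by fun_prop) (by fun_prop)]
      rfl
    have := gaussianReal_add_gaussianReal_of_indepFun (hind.comp measurable_id measurable_neg)
      (map_eval_tableLaw σ m (i, t)) hneg
    rw [two_mul]
    exact this
  indep t := by
    set S : Finset (Fin n × ℕ) := Finset.univ ×ˢ Finset.range t with hS
    set T : Finset (Fin n × ℕ) := {(i, t), (j, t)} with hT
    have hST : Disjoint S T := by
      rw [Finset.disjoint_left]
      rintro ⟨k, s⟩ h1 h2
      simp only [hS, Finset.mem_product, Finset.mem_univ, Finset.mem_range, true_and] at h1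
      simp only [hT, Finset.mem_insert, Finset.mem_singleton, Prod.mk.injEq] at h2
      omega
    have hind := (iIndepFun_tableLaw σ m).indepFun_finset S T hST fun p => measurable_pi_apply p
    set φ : (Fin n × ℕ → ℝ) → ℝ × ℝ≥0∞ := fun x =>
      (sumDiff i j t x, (alive c (sumDiff i j) t).indicator (fun _ => (1 : ℝ≥0∞)) x) with hφ
    have hφm : Measurable φ := (measurable_sumDiff i j t).prodMk
      (measurable_const.indicator (measurableSet_alive (measurable_sumDiff i j) t))
    -- The past depends only on the first `t` rounds; filling the remaining entries with zeros makes
    -- it a function of that block, disjoint from the two observations of round `t`.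
    have hcomp := hind.comp (φ := fun z : S → ℝ => φ (Function.updateFinset 0 S z))
      (ψ := fun z : T → ℝ => z ⟨(i, t), by simp [hT]⟩ - z ⟨(j, t), by simp [hT]⟩)
      (hφm.comp measurable_updateFinset) (by fun_prop)
    convert hcomp using 1
    · ext1 x
      have hx : ∀ p ∈ S,
          x p = Function.updateFinset (0 : Fin n × ℕ → ℝ) S (fun p : S => x p) p :=
          fun p hp => by
        simp [Function.updateFinset, hp]
      simp only [Function.comp_apply, hφ, Prod.mk.injEq]
      refine ⟨sumDiff_congr i j le_rfl hx, ?_⟩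
      have := alive_sumDiff_congr c i j hx
      by_cases h : x ∈ alive c (sumDiff i j) t
      · rw [Set.indicator_of_mem h, Set.indicator_of_mem (this.1 h)]
      · rw [Set.indicator_of_notMem h, Set.indicator_of_notMem (mt this.2 h)]
    · ext1 x
      exact sumDiff_succ i j t x

theorem beatsAllSet_eq (c : ℝ) (i : Fin n) :
    beatsAllSet c i = ⋂ j ∈ Finset.univ.erase i, ⋃ T, winBy c (sumDiff i j) T := by
  ext x
  simp only [beatsAllSet, Set.mem_ofPred_eq, Finset.mem_erase, Finset.mem_univ, and_true,
    Set.mem_iInter, Set.mem_iUnion]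
  refine forall₂_congr fun j _ => ⟨?_, ?_⟩
  · rintro ⟨t, h1, h2⟩
    exact ⟨t, t, le_rfl, h1, h2⟩
  · rintro ⟨_, t, -, h1, h2⟩
    exact ⟨t, h1, h2⟩

theorem measurableSet_beatsAllSet {c : ℝ} (hc : 0 < c) (i : Fin n) :
    MeasurableSet (beatsAllSet c i) := by
  rw [beatsAllSet_eq]
  exact Finset.measurableSet_biInter _ fun j _ => MeasurableSet.iUnion fun T =>
    measurableSet_winBy hc (measurable_sumDiff i j) (sumDiff_zero i j) T

/-- A higher path exceeds `c` no later, and until then it stays above a path that has not yet fallen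
below `-c`. -/
theorem winBy_of_le {Ω : Type*} {c : ℝ} {W : ℕ → Ω → ℝ} {T : ℕ} {x y : Ω}
    (h : ∀ t, W t x ≤ W t y) (hx : x ∈ winBy c W T) : y ∈ winBy c W T := by
  classical
  obtain ⟨t, ht, h1, h2⟩ := hx
  have hex : ∃ s, c < W s y := ⟨t, h1.trans_le (h t)⟩
  have hle : Nat.find hex ≤ t := Nat.find_min' hex (h1.trans_le (h t))
  refine ⟨Nat.find hex, hle.trans ht, Nat.find_spec hex, fun s hs => abs_le.2 ⟨?_, ?_⟩⟩
  · exact (abs_le.1 (h2 s (hs.trans_le hle))).1.trans (h s)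
  · exact not_lt.1 (Nat.find_min hex hs)

theorem sumDiff_mono {i j : Fin n} (hij : j ≠ i) {x y : Fin n × ℕ → ℝ}
    (h : ∀ p : Fin n × ℕ, if p.1 = i then x p ≤ y p else y p ≤ x p) (t : ℕ) :
    sumDiff i j t x ≤ sumDiff i j t y := by
  refine sub_le_sub (Finset.sum_le_sum fun s _ => ?_) (Finset.sum_le_sum fun s _ => ?_)
  · simpa using h (i, s)
  · simpa [hij] using h (j, s)

/-- The games of one arm against the others are positively correlated. -/
theorem prod_tableLaw_le {c : ℝ} (hc : 0 < c) (σ : ℝ≥0) (m : Fin n → ℝ) (i : Fin n) :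
    ∏ j ∈ Finset.univ.erase i, tableLaw σ m (⋃ T, winBy c (sumDiff i j) T) ≤
      tableLaw σ m (beatsAllSet c i) := by
  -- Harris' inequality needs finitely many coordinates, hence a finite horizon first; the limit `T
  -- → ∞` comes at the end.
  have hT : ∀ T, ∏ j ∈ Finset.univ.erase i, tableLaw σ m (winBy c (sumDiff i j) T) ≤
      tableLaw σ m (beatsAllSet c i) := fun T => by
    set r : Fin n × ℕ → ℝ → ℝ → Prop := fun p a b => if p.1 = i then a ≤ b else b ≤ a with hr
    set B : Fin n → Set (Fin n × ℕ → ℝ) :=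
      fun j => if j = i then Set.univ else winBy c (sumDiff i j) T with hB
    have hBj : ∀ j, j ≠ i → B j = winBy c (sumDiff i j) T := fun j hj => by simp [hB, hj]
    have := prod_infinitePi_le_infinitePi_iInter
      (fun p : Fin n × ℕ => gaussianReal (m p.1) (σ ^ 2)) (r := r)
      (fun p a b => by
        by_cases hp : p.1 = i
        · simpa [hr, hp] using le_total a b
        · simpa [hr, hp] using le_total b a)
      (Finset.univ ×ˢ Finset.range T) (Finset.univ.erase i) B
      (fun j => by
        by_cases hj : j = i
        · simp [hB, hj]
        · rw [hBj j hj]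
          exact measurableSet_winBy hc (measurable_sumDiff i j) (sumDiff_zero i j) T)
      (fun j x y hxy => by
        by_cases hj : j = i
        · simp [hB, hj]
        · rw [hBj j hj]; exact winBy_sumDiff_congr c i j hxy)
      (fun j x y hxy hx => by
        by_cases hj : j = i
        · simp [hB, hj]
        · rw [hBj j hj] at hx ⊢
          exact winBy_of_le (sumDiff_mono hj hxy) hx)
    rw [Finset.prod_congr rfl fun j hj => by rw [hBj j (Finset.ne_of_mem_erase hj)]] at this
    refine this.trans (measure_mono ?_)
    rw [beatsAllSet_eq]
    exact Set.iInter₂_mono fun j hj => by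
      rw [hBj j (Finset.ne_of_mem_erase hj)]
      exact Set.subset_iUnion (fun T => winBy c (sumDiff i j) T) T
  refine le_of_tendsto' (ENNReal.tendsto_finsetProd_of_ne_top _ (fun j _ =>
    tendsto_measure_iUnion_atTop (monotone_winBy c (sumDiff i j)))
    fun j _ => measure_ne_top _ _) hT

theorem prod_LB_le_tableLaw {c : ℝ} (hc : 0 < c) {σ : ℝ≥0} (hσ : 0 < σ) {m : Fin n → ℝ}
    {i : Fin n} (hm : ∀ j, j ≠ i → m j < m i) :
    ∏ j ∈ Finset.univ.erase i, ENNReal.ofReal (LB c σ (m i - m j)) ≤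
      tableLaw σ m (beatsAllSet c i) := by
  refine (Finset.prod_le_prod' fun j hj => ?_).trans (prod_tableLaw_le hc σ m i)
  have hj := Finset.ne_of_mem_erase hj
  exact ((isWalk_sumDiff σ m c hj.symm).bounds hσ hc (sub_pos.2 (hm j hj))).1

theorem tableLaw_le_UB {c : ℝ} (hc : 0 < c) {σ : ℝ≥0} (hσ : 0 < σ) {m : Fin n → ℝ}
    {i j : Fin n} (hij : j ≠ i) (hm : m j < m i) :
    tableLaw σ m (beatsAllSet c i) ≤ ENNReal.ofReal (UB c σ (m i - m j)) := by
  refine le_trans (measure_mono ?_)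
    ((isWalk_sumDiff σ m c hij.symm).bounds hσ hc (sub_pos.2 hm)).2
  rw [beatsAllSet_eq]
  exact Set.iInter₂_subset j (by simp [hij])

end Table

/-! ### The gaps between the means -/

theorem measurable_R : Measurable R := by
  have := measurable_Phi
  unfold R; fun_prop

theorem measurable_LB (c σ : ℝ) : Measurable (LB c σ) := by
  have := measurable_R
  unfold LB; fun_prop

theorem measurable_UB (c σ : ℝ) : Measurable (UB c σ) := by
  have := measurable_R
  unfold UB; fun_prop

theorem LB_mem_Icc {c σ m : ℝ} (hc : 0 < c) (hσ : 0 < σ) (hm : 0 < m) :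
    LB c σ m ∈ Set.Icc 0 1 := by
  have hr := R_neg_lt_one (a := m / (σ * √2)) (by positivity)
  have hC : 1 < Real.exp (m * c / σ ^ 2) := Real.one_lt_exp_iff.2 (by positivity)
  have hD : 0 < Real.exp (-(m * c / σ ^ 2)) := Real.exp_pos _
  have hD1 : Real.exp (-(m * c / σ ^ 2)) < 1 := by
    rw [Real.exp_neg]; exact inv_lt_one_of_one_lt₀ hC
  unfold LB
  exact ⟨div_nonneg (by linarith) (by nlinarith), div_le_one_of_le₀ (by nlinarith) (by nlinarith)⟩

theorem UB_mem_Icc {c σ m : ℝ} (hc : 0 < c) (hσ : 0 < σ) (hm : 0 < m) :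
    UB c σ m ∈ Set.Icc 0 1 := by
  have hr := one_lt_R (a := m / (σ * √2)) (by positivity)
  have hC : 1 < Real.exp (m * c / σ ^ 2) := Real.one_lt_exp_iff.2 (by positivity)
  have hD : 0 < Real.exp (-(m * c / σ ^ 2)) := Real.exp_pos _
  have hD1 : Real.exp (-(m * c / σ ^ 2)) < 1 := by
    rw [Real.exp_neg]; exact inv_lt_one_of_one_lt₀ hC
  unfold UB
  exact ⟨div_nonneg (by nlinarith) (by nlinarith), div_le_one_of_le₀ (by nlinarith) (by nlinarith)⟩

theorem image_div_pow_Ioo {k : ℕ} (hk : k ≠ 0) {w : ℝ} (hw : 0 < w) :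
    (fun s => (s / w) ^ k) '' Set.Ioo 0 w = Set.Ioo 0 1 := by
  ext v
  constructor
  · rintro ⟨s, ⟨h0, h1⟩, rfl⟩
    have : 0 < s / w := by positivity
    exact ⟨by positivity, pow_lt_one₀ this.le ((div_lt_one hw).2 h1) hk⟩
  · rintro ⟨h0, h1⟩
    have hlt : v ^ (1 / (k : ℝ)) < 1 := Real.rpow_lt_one h0.le h1 (by positivity)
    have hpos : 0 < v ^ (1 / (k : ℝ)) := Real.rpow_pos_of_pos h0 _
    refine ⟨w * v ^ (1 / (k : ℝ)), ⟨by positivity, by nlinarith⟩, ?_⟩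
    simp only
    rw [mul_div_cancel_left₀ _ hw.ne', one_div, Real.rpow_inv_natCast_pow h0.le hk]

/-- Substitution `v = (s/w)^k`: for uniform `v`, the variable `w * v^(1/k)` has the law of the
maximum of `k` independent uniforms on `(0, w)`. -/
theorem setLIntegral_mul_rpow {k : ℕ} (hk : k ≠ 0) {w : ℝ} (hw : 0 < w) (f : ℝ → ℝ≥0∞) :
    ∫⁻ v in Set.Ioo 0 1, f (w * v ^ (1 / (k : ℝ))) =
      ∫⁻ s in Set.Ioo 0 w, ENNReal.ofReal (k * s ^ (k - 1) / w ^ k) * f s := by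
  rw [← image_div_pow_Ioo hk hw, lintegral_image_eq_lintegral_abs_deriv_mul measurableSet_Ioo
    (f := fun s => (s / w) ^ k) (f' := fun s => k * (s / w) ^ (k - 1) * (1 / w))
    (fun s _ => (((hasDerivAt_id s).div_const w).pow k).hasDerivWithinAt)]
  · refine setLIntegral_congr_fun measurableSet_Ioo fun s hs => ?_
    have hs0 : 0 < s := hs.1
    have h1 : w * ((s / w) ^ k) ^ (1 / (k : ℝ)) = s := by
      rw [one_div, Real.pow_rpow_inv_natCast (by positivity) hk]
      field_simp
    simp only [h1]
    rw [abs_of_nonneg (by positivity)]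
    congr 2
    obtain ⟨l, rfl⟩ := Nat.exists_eq_succ_of_ne_zero hk
    simp only [Nat.succ_eq_add_one, Nat.add_sub_cancel, div_pow, pow_succ]
    field_simp
  · intro s hs r hr hsr
    have h1 : 0 ≤ s / w := div_nonneg hs.1.le hw.le
    have h2 : 0 ≤ r / w := div_nonneg hr.1.le hw.le
    have := (pow_left_inj₀ h1 h2 hk).1 hsr
    field_simp at this
    exact this

/-- Expectations of functions of the largest mean `x` and a smaller mean `y`, in terms of
uniform variables. -/
theorem lintegral_uniform_eq {n k : ℕ} (hn : n ≠ 0) (hk : k ≠ 0) (F : ℝ → ℝ → ℝ≥0∞) :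
    ∫⁻ u in Set.Ioo (0 : ℝ) 1, ∫⁻ v in Set.Ioo (0 : ℝ) 1,
        F (PhiInv (u ^ (1 / (n : ℝ)))) (PhiInv (u ^ (1 / (n : ℝ)) * v ^ (1 / (k : ℝ)))) =
      ∫⁻ x, ENNReal.ofReal (n * Phi x ^ (n - 1)) * ∫⁻ y in Set.Iio x,
        ENNReal.ofReal (k * Phi y ^ (k - 1) / Phi x ^ k) * F x y
          ∂(gaussianReal 0 1) ∂(gaussianReal 0 1) := by
  set J : ℝ → ℝ≥0∞ := fun w => ∫⁻ s in Set.Ioo 0 w,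
    ENNReal.ofReal (k * s ^ (k - 1) / w ^ k) * F (PhiInv w) (PhiInv s) with hJ
  have h1 : ∫⁻ u in Set.Ioo (0 : ℝ) 1, ∫⁻ v in Set.Ioo (0 : ℝ) 1,
        F (PhiInv (u ^ (1 / (n : ℝ)))) (PhiInv (u ^ (1 / (n : ℝ)) * v ^ (1 / (k : ℝ)))) =
      ∫⁻ u in Set.Ioo (0 : ℝ) 1, J (1 * u ^ (1 / (n : ℝ))) :=
    setLIntegral_congr_fun measurableSet_Ioo fun u hu => by
      simp only [one_mul, hJ]
      exact setLIntegral_mul_rpow hk (Real.rpow_pos_of_pos hu.1 _)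
        fun s => F (PhiInv (u ^ (1 / (n : ℝ)))) (PhiInv s)
  rw [h1, setLIntegral_mul_rpow hn one_pos, ← Phi_image_univ, setLIntegral_Phi MeasurableSet.univ,
    Measure.restrict_univ]
  refine lintegral_congr fun x => ?_
  rw [one_pow, div_one, hJ]
  simp only
  rw [← Phi_image_Iio, setLIntegral_Phi measurableSet_Iio]
  simp only [PhiInv_Phi]

theorem lintegral_Phi_pow {n : ℕ} (hn : n ≠ 0) :
    ∫⁻ x, ENNReal.ofReal (n * Phi x ^ (n - 1)) ∂(gaussianReal 0 1) = 1 := by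
  have := setLIntegral_mul_rpow hn one_pos fun _ => 1
  rw [← Phi_image_univ, setLIntegral_Phi MeasurableSet.univ, setLIntegral_Phi MeasurableSet.univ,
    Measure.restrict_univ] at this
  simpa using this.symm

/-- Jensen's inequality for powers, by induction: `f ^ k` and `f` vary together, so Chebyshev's
inequality applies. -/
theorem pow_lintegral_le {α : Type*} [MeasurableSpace α] (μ : Measure α) [IsProbabilityMeasure μ]
    {f : α → ℝ≥0∞} (hf : Measurable f) (k : ℕ) : (∫⁻ x, f x ∂μ) ^ k ≤ ∫⁻ x, f x ^ k ∂μ := by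
  induction k with
  | zero => simp
  | succ k ih =>
    have := lintegral_mul_lintegral_le_of_monovary μ (hf.pow_const k) hf fun x y => by
      rcases le_total (f x) (f y) with h | h
      · exact Or.inl ⟨pow_le_pow_left' h k, h⟩
      · exact Or.inr ⟨pow_le_pow_left' h k, h⟩
    simp only [measure_univ, one_mul] at this
    simp only [pow_succ]
    exact (mul_le_mul_left ih _).trans this

theorem pow_lintegral_uniform_le {k : ℕ} {F : ℝ → ℝ → ℝ≥0∞} (hF : Measurable F.uncurry) :
    (∫⁻ u in Set.Ioo (0 : ℝ) 1, ∫⁻ v in Set.Ioo (0 : ℝ) 1,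
        F (PhiInv (u ^ (1 / ((k + 1 : ℕ) : ℝ)))) (PhiInv (u ^ (1 / ((k + 1 : ℕ) : ℝ)) * v))) ^ k ≤
      (k + 1 : ℕ) * ∫⁻ x, (∫⁻ y in Set.Iio x, F x y ∂(gaussianReal 0 1)) ^ k
        ∂(gaussianReal 0 1) := by
  have h := lintegral_uniform_eq (n := k + 1) (k := 1) (by simp) one_ne_zero F
  simp only [Nat.cast_one, div_one, Real.rpow_one, Nat.sub_self, pow_zero, mul_one,
    pow_one, Nat.add_sub_cancel] at h
  rw [h]
  have hΦ := measurable_Phi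
  set G : ℝ → ℝ≥0∞ := fun x => ∫⁻ y in Set.Iio x, F x y ∂(gaussianReal 0 1) with hG
  have hGm : Measurable G := by
    have : G = fun x => ∫⁻ y, ({z : ℝ × ℝ | z.2 < z.1}.indicator F.uncurry) (x, y)
        ∂(gaussianReal 0 1) := by
      ext x
      simp only [hG]
      rw [← lintegral_indicator measurableSet_Iio]
      rfl
    rw [this]
    exact (hF.indicator (measurableSet_lt measurable_snd measurable_fst)).lintegral_prod_right'
  have hden : Measurable fun x => ENNReal.ofReal (((k + 1 : ℕ) : ℝ) * Phi x ^ k) := by fun_prop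
  -- The law of the largest of `k + 1` standard normals. Jensen is applied to the conditional mean
  -- `G x / Φ(x)`, whose denominator then cancels the density's `Φ(x)^k`.
  set ν := (gaussianReal 0 1).withDensity fun x => ENNReal.ofReal (((k + 1 : ℕ) : ℝ) * Phi x ^ k)
    with hν
  have : IsProbabilityMeasure ν := ⟨by
    rw [hν, withDensity_apply _ MeasurableSet.univ, Measure.restrict_univ]
    exact lintegral_Phi_pow (n := k + 1) (by simp)⟩
  have hHm : Measurable fun x => ENNReal.ofReal (1 / Phi x) * G x := by fun_prop
  have hj := pow_lintegral_le ν hHm k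
  rw [hν, lintegral_withDensity_eq_lintegral_mul _ hden hHm,
    lintegral_withDensity_eq_lintegral_mul _ hden (hHm.pow_const k)] at hj
  have e1 : ∀ x, ∫⁻ y in Set.Iio x, ENNReal.ofReal (1 / Phi x) * F x y ∂(gaussianReal 0 1) =
      ENNReal.ofReal (1 / Phi x) * G x := fun x => lintegral_const_mul' _ _ (by simp)
  simp_rw [e1]
  refine hj.trans_eq ?_
  rw [← lintegral_const_mul' _ _ (by simp)]
  refine lintegral_congr fun x => ?_
  have hx := Phi_pos x
  rw [Pi.mul_apply, mul_pow, ← ENNReal.ofReal_pow (by positivity), ← mul_assoc,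
    ← ENNReal.ofReal_mul (by positivity)]
  congr 1
  rw [mul_assoc, ← mul_pow, mul_one_div_cancel hx.ne', one_pow, mul_one, ENNReal.ofReal_natCast]

/-! ### Splitting off one mean -/

theorem lintegral_pi_succAbove {k : ℕ} (i : Fin (k + 1)) {H : ℝ → (Fin k → ℝ) → ℝ≥0∞}
    (hH : Measurable H.uncurry) :
    ∫⁻ m, H (m i) (fun a => m (i.succAbove a)) ∂(Measure.pi fun _ : Fin (k + 1) =>
        gaussianReal 0 1) =
      ∫⁻ x, ∫⁻ z, H x z ∂(Measure.pi fun _ : Fin k => gaussianReal 0 1) ∂(gaussianReal 0 1) := by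
  have h := (measurePreserving_piFinSuccAbove (fun _ : Fin (k + 1) => gaussianReal 0 1) i)
  rw [← lintegral_prod (fun z : ℝ × (Fin k → ℝ) => H z.1 z.2) hH.aemeasurable]
  exact h.lintegral_comp hH

theorem lintegral_pi_prod {k : ℕ} {f : ℝ → ℝ≥0∞} (hf : Measurable f) :
    ∫⁻ z, ∏ a, f (z a) ∂(Measure.pi fun _ : Fin k => gaussianReal 0 1) =
      (∫⁻ y, f y ∂(gaussianReal 0 1)) ^ k := by
  induction k with
  | zero => simp
  | succ k ih =>
    have e : ∀ z : Fin (k + 1) → ℝ, ∏ a, f (z a) = f (z 0) * ∏ a, f (z (Fin.succAbove 0 a)) :=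
      fun z => Fin.prod_univ_succAbove _ 0
    simp_rw [e]
    rw [lintegral_pi_succAbove 0 (H := fun x z => f x * ∏ a, f (z a)) (by
      unfold Function.uncurry; fun_prop)]
    have hm : Measurable fun z : Fin k → ℝ => ∏ a, f (z a) := by fun_prop
    simp_rw [lintegral_const_mul _ hm, ih]
    rw [lintegral_mul_const _ hf, pow_succ, mul_comm]

/-- Once `m i = x` is fixed, integrand and constraint factor over the other `k` means, and all
factors have the same integral. -/
theorem lintegral_best {k : ℕ} (i : Fin (k + 1)) {F : ℝ → ℝ → ℝ≥0∞} (hF : Measurable F.uncurry) :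
    ∫⁻ m in {m | ∀ j, j ≠ i → m j < m i}, ∏ j ∈ Finset.univ.erase i, F (m i) (m j)
        ∂(Measure.pi fun _ : Fin (k + 1) => gaussianReal 0 1) =
      ∫⁻ x, (∫⁻ y in Set.Iio x, F x y ∂(gaussianReal 0 1)) ^ k ∂(gaussianReal 0 1) := by
  set S : Set (Fin (k + 1) → ℝ) := {m | ∀ j, j ≠ i → m j < m i} with hSdef
  have hS : MeasurableSet S := by
    have : S = ⋂ j, ⋂ (_ : j ≠ i), {m | m j < m i} := by ext; simp [hSdef]
    rw [this]
    exact MeasurableSet.iInter fun j => MeasurableSet.iInter fun _ =>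
      measurableSet_lt (measurable_pi_apply _) (measurable_pi_apply _)
  set F' : ℝ → ℝ → ℝ≥0∞ := fun x => (Set.Iio x).indicator (F x) with hF'
  have hF'm : Measurable F'.uncurry :=
    hF.indicator (measurableSet_lt measurable_snd measurable_fst :
      MeasurableSet {z : ℝ × ℝ | z.2 < z.1})
  have hF'x : ∀ x, Measurable (F' x) := fun x => hF'm.comp measurable_prodMk_left
  rw [← lintegral_indicator hS]
  have e1 : ∀ m : Fin (k + 1) → ℝ,
      S.indicator (fun m => ∏ j ∈ Finset.univ.erase i, F (m i) (m j)) m =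
      ∏ a, F' (m i) (m (i.succAbove a)) := fun m => by
    have himg : Finset.univ.erase i = Finset.univ.image i.succAbove := by
      rw [Fin.image_succAbove_univ, Finset.compl_singleton]
    by_cases hm : m ∈ S
    · rw [Set.indicator_of_mem hm, himg, Finset.prod_image Fin.succAbove_right_injective.injOn]
      exact Finset.prod_congr rfl fun a _ => by
        simp [hF', show m (i.succAbove a) < m i from hm _ (Fin.succAbove_ne i a)]
    · rw [Set.indicator_of_notMem hm]
      simp only [hSdef, Set.mem_ofPred_eq] at hm
      push Not at hm
      obtain ⟨j, hj, hle⟩ := hm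
      obtain ⟨a, rfl⟩ := Fin.exists_succAbove_eq hj
      exact (Finset.prod_eq_zero (Finset.mem_univ a) (by simp [hF', hle])).symm
  simp_rw [e1]
  rw [lintegral_pi_succAbove i (H := fun x z => ∏ a, F' x (z a)) (by
    refine Finset.measurable_prod _ fun a _ => hF'm.comp
      (measurable_fst.prodMk ((measurable_pi_apply a).comp measurable_snd)))]
  refine lintegral_congr fun x => ?_
  rw [lintegral_pi_prod (hF'x x), ← lintegral_indicator measurableSet_Iio]

theorem measurable_ite_le_and_forall_le {α : Type*} [MeasurableSpace α] {k : ℕ}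
    {g : ℝ → ℝ → ℝ≥0∞} (hg : Measurable g.uncurry) {p q : α → ℝ} {r : Fin k → α → ℝ}
    (hp : Measurable p) (hq : Measurable q) (hr : ∀ b, Measurable (r b)) :
    Measurable fun z => if q z ≤ p z ∧ ∀ b, r b z ≤ q z then g (p z) (q z) else 0 := by
  refine Measurable.ite ((measurableSet_le hq hp).inter ?_) (hg.comp (hp.prodMk hq))
    measurable_const
  have : {z | ∀ b, r b z ≤ q z} = ⋂ b, {z | r b z ≤ q z} := by ext; simp
  change MeasurableSet {z | ∀ b, r b z ≤ q z}
  rw [this]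
  exact MeasurableSet.iInter fun b => measurableSet_le (hr b) hq

/-- With the best mean `x` and the second best `y` split off, the other `k` means lie below `y` with
probability `Φ(y)^k`. -/
theorem lintegral_best_second {k : ℕ} (i : Fin (k + 2)) (a : Fin (k + 1)) {g : ℝ → ℝ → ℝ≥0∞}
    (hg : Measurable g.uncurry) :
    ∫⁻ m, (if m (i.succAbove a) ≤ m i ∧
        ∀ b, m (i.succAbove (a.succAbove b)) ≤ m (i.succAbove a) then
        g (m i) (m (i.succAbove a)) else 0)
        ∂(Measure.pi fun _ : Fin (k + 2) => gaussianReal 0 1) =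
      ∫⁻ x, ∫⁻ y in Set.Iio x, ENNReal.ofReal (Phi y ^ k) * g x y
        ∂(gaussianReal 0 1) ∂(gaussianReal 0 1) := by
  rw [lintegral_pi_succAbove i (H := fun x z => if z a ≤ x ∧ ∀ b, z (a.succAbove b) ≤ z a then
    g x (z a) else 0) (measurable_ite_le_and_forall_le (α := ℝ × (Fin (k + 1) → ℝ)) hg
      measurable_fst ((measurable_pi_apply a).comp measurable_snd)
      (r := fun b z => z.2 (a.succAbove b)) (by fun_prop))]
  refine lintegral_congr fun x => ?_
  rw [lintegral_pi_succAbove a (H := fun y u => if y ≤ x ∧ ∀ b, u b ≤ y then g x y else 0)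
    (measurable_ite_le_and_forall_le (α := ℝ × (Fin k → ℝ)) hg (p := fun _ => x)
      (r := fun b z => z.2 b) measurable_const measurable_fst (by fun_prop))]
  have := nullSingletonClass_gaussianReal (μ := 0) (v := 1) one_ne_zero
  rw [restrict_Iio_eq_restrict_Iic, ← lintegral_indicator measurableSet_Iic]
  refine lintegral_congr fun y => ?_
  have e : ∀ u : Fin k → ℝ, (if y ≤ x ∧ ∀ b, u b ≤ y then g x y else 0) =
      (Set.univ.pi fun _ : Fin k => Set.Iic y).indicator
        (fun _ => if y ≤ x then g x y else 0) u := fun u => by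
    by_cases h1 : y ≤ x <;> by_cases h2 : ∀ b, u b ≤ y <;>
      simp [h1, h2, Set.indicator, Pi.le_def]
  simp_rw [e]
  rw [lintegral_indicator_const (MeasurableSet.univ_pi fun _ => measurableSet_Iic), Measure.pi_pi]
  simp only [Finset.prod_const, Finset.card_univ, Fintype.card_fin]
  rw [← ofReal_Phi, ← ENNReal.ofReal_pow (Phi_pos y).le]
  by_cases h : y ≤ x <;> simp [h, mul_comm]

/-- The powers of `Φ(x)` in the density of the maximum and in the conditional density of the
runner-up cancel. The factor `(k + 2)(k + 1)` counts the choices of best and second best arm. -/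
theorem lintegral_uniform_second_eq {k : ℕ} {F : ℝ → ℝ → ℝ≥0∞} :
    ∫⁻ u in Set.Ioo (0 : ℝ) 1, ∫⁻ v in Set.Ioo (0 : ℝ) 1,
        F (PhiInv (u ^ (1 / ((k + 2 : ℕ) : ℝ))))
          (PhiInv (u ^ (1 / ((k + 2 : ℕ) : ℝ)) * v ^ (1 / ((k + 1 : ℕ) : ℝ)))) =
      (k + 2 : ℕ) * ((k + 1 : ℕ) * ∫⁻ x, ∫⁻ y in Set.Iio x, ENNReal.ofReal (Phi y ^ k) * F x y
        ∂(gaussianReal 0 1) ∂(gaussianReal 0 1)) := by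
  rw [lintegral_uniform_eq (by simp) (by simp) F, ← lintegral_const_mul' _ _ (by simp),
    ← lintegral_const_mul' _ _ (by simp)]
  refine lintegral_congr fun x => ?_
  rw [← lintegral_const_mul' _ _ (by simp), ← lintegral_const_mul' _ _ (by simp),
    ← lintegral_const_mul' _ _ (by simp)]
  refine lintegral_congr fun y => ?_
  have hx := Phi_pos x
  have hy := Phi_pos y
  rw [← ENNReal.ofReal_natCast (k + 2), ← ENNReal.ofReal_natCast (k + 1), ← mul_assoc, ← mul_assoc,
    ← mul_assoc, ← ENNReal.ofReal_mul (by positivity), ← ENNReal.ofReal_mul (by positivity),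
    ← ENNReal.ofReal_mul (by positivity)]
  congr 2
  simp only [Nat.add_sub_cancel, show k + 2 - 1 = k + 1 by omega]
  field_simp

/-! ### Beating every other arm suffices for being recommended -/

theorem remaining_antitone {n : ℕ} (c : ℝ) (x : Fin n → ℕ → ℝ) : Antitone (remaining c x) :=
  antitone_nat_of_succ_le fun _ _ h => h.1

theorem notMem_remaining_of_beats {n : ℕ} {c : ℝ} (hc : 0 < c) {x : Fin n → ℕ → ℝ} {i j : Fin n}
    (hji : j ≠ i) {s : ℕ} (hs : c < partialSum x i s - partialSum x j s)
    (hi : i ∈ remaining c x (s - 1)) : j ∉ remaining c x s := by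
  cases s with
  | zero => simp only [partialSum, Finset.range_zero, Finset.sum_empty] at hs; linarith
  | succ r => exact fun h => h.2 ⟨i, hi, hji.symm, by linarith⟩

theorem recommends_of_beats {n : ℕ} {c : ℝ} (hc : 0 < c) {x : Fin n → ℕ → ℝ} {i : Fin n}
    (h : ∀ j, j ≠ i → Beats c x i j) : Recommends c x i := by
  have hi : ∀ t, i ∈ remaining c x t := by
    intro t
    induction t with
    | zero => trivial
    | succ t ih =>
      refine ⟨ih, ?_⟩
      rintro ⟨j, hj, hji, hlt⟩
      obtain ⟨s, h1, h2⟩ := h j hji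
      -- Here `s` ends the game against `j`: after it `j` is already eliminated, at it `i` is ahead,
      -- and before it `i` cannot be more than `c` behind.
      rcases lt_trichotomy s (t + 1) with hs | rfl | hs
      · exact notMem_remaining_of_beats hc hji h1 (remaining_antitone c x (by omega) ih)
          (remaining_antitone c x (by omega) hj)
      · linarith
      · have := (abs_le.1 (h2 _ hs)).1
        linarith
  choose f hf using fun j : {j // j ≠ i} => h j j.2
  refine ⟨Finset.univ.sup f, Set.eq_singleton_iff_unique_mem.2 ⟨hi _, fun j hj => ?_⟩⟩
  by_contra hji
  exact notMem_remaining_of_beats hc hji (hf ⟨j, hji⟩).1 (hi _)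
    (remaining_antitone c x (Finset.le_sup (Finset.mem_univ (⟨j, hji⟩ : {j // j ≠ i}))) hj)

theorem beatsAllEvent_subset_correctEvent {Ω : Type*} {n : ℕ} {c : ℝ} (hc : 0 < c)
    (θ : Fin n → Ω → ℝ) (rew : Fin n → ℕ → Ω → ℝ) : beatsAllEvent c θ rew ⊆ correctEvent c θ rew :=
  fun _ ⟨i, hbest, hi⟩ => ⟨i, hbest, recommends_of_beats hc hi⟩

/-! ### Integrating the bounds over the means -/

section Bandit

variable {Ω : Type*} [MeasurableSpace Ω] {P : Measure Ω} {σ : ℝ≥0} {c : ℝ}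

theorem measurable_ofReal_LB_sub (c σ : ℝ) :
    Measurable (Function.uncurry fun x y : ℝ => ENNReal.ofReal (LB c σ (x - y))) :=
  ((measurable_LB c σ).comp (measurable_fst.sub measurable_snd)).ennreal_ofReal

theorem pow_le_measure_beatsAllEvent {k : ℕ} {θ : Fin (k + 1) → Ω → ℝ}
    {rew : Fin (k + 1) → ℕ → Ω → ℝ} (hb : IsNormalBandit P σ θ rew) (hσ : 0 < σ) (hc : 0 < c) :
    (∫⁻ u in Set.Ioo (0 : ℝ) 1, ∫⁻ v in Set.Ioo (0 : ℝ) 1,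
      ENNReal.ofReal (LB c σ (gapX (k + 1) u v))) ^ k ≤ P (beatsAllEvent c θ rew) := by
  refine (pow_lintegral_uniform_le (measurable_ofReal_LB_sub c σ)).trans ?_
  -- Strict inequalities make the events for different best arms disjoint, so their probabilities
  -- add. Ties may be dropped in a lower bound.
  set A : Fin (k + 1) → Set (Fin (k + 1) → ℝ) := fun i => {m | ∀ j, j ≠ i → m j < m i} with hA
  have hAm : ∀ i, MeasurableSet (A i) := fun i => by
    have : A i = ⋂ j, ⋂ (_ : j ≠ i), {m | m j < m i} := by ext; simp [hA]
    rw [this]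
    exact MeasurableSet.iInter fun j => MeasurableSet.iInter fun _ =>
      measurableSet_lt (measurable_pi_apply _) (measurable_pi_apply _)
  set E : Fin (k + 1) → Set Ω := fun i => {ω | (fun j => θ j ω) ∈ A i ∧
    (fun p : Fin (k + 1) × ℕ => rew p.1 p.2 ω) ∈ beatsAllSet c i} with hE
  have hsub : (⋃ i, E i) ⊆ beatsAllEvent c θ rew := by
    refine Set.iUnion_subset fun i ω hω => ⟨i, fun j => ?_, hω.2⟩
    by_cases hj : j = i
    · rw [hj]
    · exact (hω.1 j hj).le
  refine le_trans ?_ (measure_mono hsub)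
  have hEm : ∀ i, MeasurableSet (E i) := fun i =>
    (hAm i |>.preimage (measurable_pi_iff.2 hb.measurable_mean)).inter
    ((measurableSet_beatsAllSet hc i).preimage
      (measurable_pi_iff.2 fun p => hb.measurable_rew p.1 p.2))
  have hdisj : Pairwise (Function.onFun Disjoint E) := fun i j hij =>
    Set.disjoint_left.2 fun ω hi hj => lt_asymm (hi.1 j hij.symm) (hj.1 i hij)
  rw [measure_iUnion hdisj hEm, tsum_fintype]
  calc _ = ∑ i : Fin (k + 1), ∫⁻ x, (∫⁻ y in Set.Iio x, ENNReal.ofReal (LB c σ (x - y))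
        ∂(gaussianReal 0 1)) ^ k ∂(gaussianReal 0 1) := by simp
    _ ≤ _ := Finset.sum_le_sum fun i _ => by
      rw [← lintegral_best i (measurable_ofReal_LB_sub c σ), hE,
        hb.joint_law _ _ (hAm i) (measurableSet_beatsAllSet hc i)]
      exact setLIntegral_mono' (hAm i) fun m hm => prod_LB_le_tableLaw hc hσ hm

theorem measure_beatsAllEvent_le {k : ℕ} {θ : Fin (k + 2) → Ω → ℝ}
    {rew : Fin (k + 2) → ℕ → Ω → ℝ} (hb : IsNormalBandit P σ θ rew) (hσ : 0 < σ) (hc : 0 < c) :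
    P (beatsAllEvent c θ rew) ≤ ∫⁻ u in Set.Ioo (0 : ℝ) 1, ∫⁻ v in Set.Ioo (0 : ℝ) 1,
      ENNReal.ofReal (UB c σ (gapY (k + 2) u v)) := by
  -- At a tie `UB` is `0 / 0`, which evaluates to `0` and is no bound; the trivial bound `1`
  -- replaces it. The final integral runs over `y < x` only and is unaffected.
  set g : ℝ → ℝ → ℝ≥0∞ := fun x y => if y < x then ENNReal.ofReal (UB c σ (x - y)) else 1 with hg
  have hgm : Measurable g.uncurry :=
    Measurable.ite (measurableSet_lt measurable_snd measurable_fst)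
      ((measurable_UB c σ).comp (measurable_fst.sub measurable_snd)).ennreal_ofReal
      measurable_const
  have hexp : 1 / (((k + 2 : ℕ) : ℝ) - 1) = 1 / ((k + 1 : ℕ) : ℝ) := by
    push_cast; congr 1; ring
  simp only [gapY, hexp]
  rw [lintegral_uniform_second_eq (F := fun x y => ENNReal.ofReal (UB c σ (x - y)))]
  have hFg : ∀ x : ℝ,
      ∫⁻ y in Set.Iio x, ENNReal.ofReal (Phi y ^ k) * ENNReal.ofReal (UB c σ (x - y))
      ∂(gaussianReal 0 1) = ∫⁻ y in Set.Iio x, ENNReal.ofReal (Phi y ^ k) * g x y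
      ∂(gaussianReal 0 1) := fun x => setLIntegral_congr_fun measurableSet_Iio fun y hy => by
    simp [hg, Set.mem_Iio.1 hy]
  simp_rw [hFg]
  set A : Fin (k + 2) → Set (Fin (k + 2) → ℝ) := fun i => {m | ∀ j, m j ≤ m i} with hA
  have hAm : ∀ i, MeasurableSet (A i) := fun i => by
    have : A i = ⋂ j, {m | m j ≤ m i} := by ext; simp [hA]
    rw [this]
    exact MeasurableSet.iInter fun j =>
      measurableSet_le (measurable_pi_apply _) (measurable_pi_apply _)
  have hsub : beatsAllEvent c θ rew ⊆ ⋃ i, {ω | (fun j => θ j ω) ∈ A i ∧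
      (fun p : Fin (k + 2) × ℕ => rew p.1 p.2 ω) ∈ beatsAllSet c i} :=
    fun ω ⟨i, h1, h2⟩ => Set.mem_iUnion.2 ⟨i, h1, h2⟩
  refine (measure_mono hsub).trans ((measure_iUnion_le _).trans ?_)
  rw [tsum_fintype]
  set I := ∫⁻ x, ∫⁻ y in Set.Iio x, ENNReal.ofReal (Phi y ^ k) * g x y
      ∂(gaussianReal 0 1) ∂(gaussianReal 0 1) with hI
  calc _ ≤ ∑ i : Fin (k + 2), ∑ a : Fin (k + 1), I := Finset.sum_le_sum fun i _ => ?_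
    _ = _ := by simp
  rw [hb.joint_law _ _ (hAm i) (measurableSet_beatsAllSet hc i)]
  rw [Finset.sum_congr rfl fun a _ => (lintegral_best_second i a hgm).symm,
    ← lintegral_finsetSum _ fun a _ => measurable_ite_le_and_forall_le hgm
      (r := fun b (m : Fin (k + 2) → ℝ) => m (i.succAbove (a.succAbove b)))
      (measurable_pi_apply _) (measurable_pi_apply _) fun b => measurable_pi_apply _]
  refine le_trans (setLIntegral_mono' (hAm i) fun m hm => ?_) (setLIntegral_le_lintegral (A i) _)
  change tableLaw σ m (beatsAllSet c i) ≤ _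
  -- A second best arm; its term alone in the sum over all candidates suffices, the others being
  -- nonnegative.
  obtain ⟨a, ha⟩ := Finite.exists_max fun a => m (i.succAbove a)
  refine le_trans ?_ (Finset.single_le_sum (fun _ _ => zero_le) (Finset.mem_univ a))
  rw [if_pos ⟨hm _, fun b => ha _⟩, hg]
  by_cases hlt : m (i.succAbove a) < m i
  · simpa only [if_pos hlt] using tableLaw_le_UB hc hσ (Fin.succAbove_ne i a) hlt
  · simpa only [if_neg hlt] using prob_le_one

end Bandit

/-! ### Expectations over the uniform variables -/

section Uniform

variable {Ω' : Type*} [MeasurableSpace Ω'] {Q : Measure Ω'} {U V : Ω' → ℝ}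

theorem map_isUniform (hU : pdf.IsUniform U (Set.Ioo (0 : ℝ) 1) Q) :
    Q.map U = volume.restrict (Set.Ioo (0 : ℝ) 1) := by
  rw [hU, ProbabilityTheory.cond]
  simp

variable [IsProbabilityMeasure Q]

theorem map_prodMk_isUniform (hU : pdf.IsUniform U (Set.Ioo (0 : ℝ) 1) Q)
    (hV : pdf.IsUniform V (Set.Ioo (0 : ℝ) 1) Q) (hUV : IndepFun U V Q) :
    Q.map (fun ω => (U ω, V ω)) =
      (volume.restrict (Set.Ioo (0 : ℝ) 1)).prod (volume.restrict (Set.Ioo (0 : ℝ) 1)) := by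
  have hUm : AEMeasurable U Q := hU.aemeasurable (by simp) (by simp)
  have hVm : AEMeasurable V Q := hV.aemeasurable (by simp) (by simp)
  rw [(indepFun_iff_map_prod_eq_prod_map_map hUm hVm).1 hUV, map_isUniform hU, map_isUniform hV]

/-- Almost surely `(U, V)` lies in the open unit square, where `f` is bounded, so default values of
`f` elsewhere are irrelevant. Independence turns the expectation into an iterated integral. -/
theorem integrable_isUniform (hU : pdf.IsUniform U (Set.Ioo (0 : ℝ) 1) Q)
    (hV : pdf.IsUniform V (Set.Ioo (0 : ℝ) 1) Q) (hUV : IndepFun U V Q) {f : ℝ → ℝ → ℝ}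
    (hf : Measurable f.uncurry)
    (h01 : ∀ u ∈ Set.Ioo (0 : ℝ) 1, ∀ v ∈ Set.Ioo (0 : ℝ) 1, f u v ∈ Set.Icc (0 : ℝ) 1) :
    Integrable (fun ω => f (U ω) (V ω)) Q ∧ 0 ≤ ∫ ω, f (U ω) (V ω) ∂Q ∧
    ENNReal.ofReal (∫ ω, f (U ω) (V ω) ∂Q) =
      ∫⁻ u in Set.Ioo (0 : ℝ) 1, ∫⁻ v in Set.Ioo (0 : ℝ) 1, ENNReal.ofReal (f u v) := by
  have hUm : AEMeasurable U Q := hU.aemeasurable (by simp) (by simp)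
  have hVm : AEMeasurable V Q := hV.aemeasurable (by simp) (by simp)
  have hUV' := hUm.prodMk hVm
  have hUae : ∀ᵐ ω ∂Q, U ω ∈ Set.Ioo (0 : ℝ) 1 := ae_of_ae_map hUm (by
    rw [map_isUniform hU]; exact ae_restrict_mem measurableSet_Ioo)
  have hVae : ∀ᵐ ω ∂Q, V ω ∈ Set.Ioo (0 : ℝ) 1 := ae_of_ae_map hVm (by
    rw [map_isUniform hV]; exact ae_restrict_mem measurableSet_Ioo)
  have hae : ∀ᵐ ω ∂Q, f (U ω) (V ω) ∈ Set.Icc (0 : ℝ) 1 := by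
    filter_upwards [hUae, hVae] with ω h1 h2 using h01 _ h1 _ h2
  have hint : Integrable (fun ω => f (U ω) (V ω)) Q :=
    Integrable.of_mem_Icc 0 1 (hf.comp_aemeasurable hUV') hae
  have hnn : 0 ≤ᵐ[Q] fun ω => f (U ω) (V ω) := hae.mono fun _ h => h.1
  refine ⟨hint, integral_nonneg_of_ae hnn, ?_⟩
  rw [ofReal_integral_eq_lintegral_ofReal hint hnn,
    ← lintegral_prod (fun z : ℝ × ℝ => ENNReal.ofReal (f z.1 z.2)) hf.ennreal_ofReal.aemeasurable,
    ← map_prodMk_isUniform hU hV hUV,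
    lintegral_map' (f := fun z : ℝ × ℝ => ENNReal.ofReal (f z.1 z.2))
      hf.ennreal_ofReal.aemeasurable hUV']

theorem measurable_gapX (n : ℕ) : Measurable (gapX n).uncurry := by
  have := measurable_PhiInv
  unfold gapX Function.uncurry; fun_prop

theorem measurable_gapY (n : ℕ) : Measurable (gapY n).uncurry := by
  have := measurable_PhiInv
  unfold gapY Function.uncurry; fun_prop

theorem gapX_pos {n : ℕ} (hn : 0 < n) {u v : ℝ} (hu : u ∈ Set.Ioo (0 : ℝ) 1)
    (hv : v ∈ Set.Ioo (0 : ℝ) 1) : 0 < gapX n u v := by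
  have hlt : u ^ (1 / (n : ℝ)) < 1 := Real.rpow_lt_one hu.1.le hu.2 (by positivity)
  have hpos : 0 < u ^ (1 / (n : ℝ)) := Real.rpow_pos_of_pos hu.1 _
  exact sub_pos.2 (PhiInv_lt_PhiInv (mul_pos hpos hv.1) (mul_lt_of_lt_one_right hpos hv.2) hlt)

theorem gapY_pos {n : ℕ} (hn : 1 < n) {u v : ℝ} (hu : u ∈ Set.Ioo (0 : ℝ) 1)
    (hv : v ∈ Set.Ioo (0 : ℝ) 1) : 0 < gapY n u v := by
  have hn' : (0 : ℝ) < n - 1 := sub_pos.2 (by exact_mod_cast hn)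
  -- `gapY n u v` is by definition `gapX n u` at `v ^ (1 / (n - 1))`, which again lies in `(0, 1)`.
  exact gapX_pos (by omega) hu
    ⟨Real.rpow_pos_of_pos hv.1 _, Real.rpow_lt_one hv.1.le hv.2 (by positivity)⟩

end Uniform

end NormalVT

open NormalVT in
theorem mainTheorem6
    {Ω : Type*} [MeasurableSpace Ω] (P : Measure Ω) [IsProbabilityMeasure P]
    {Ω' : Type*} [MeasurableSpace Ω'] (Q : Measure Ω') [IsProbabilityMeasure Q]
    (n : ℕ) (hn : 2 ≤ n) (σ : ℝ≥0) (hσ : 0 < σ) (c : ℝ) (hc : 0 < c)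
    (θ : Fin n → Ω → ℝ) (rew : Fin n → ℕ → Ω → ℝ)
    (hbandit : NormalVT.IsNormalBandit P σ θ rew)
    (U V : Ω' → ℝ)
    (hU : pdf.IsUniform U (Set.Ioo (0 : ℝ) 1) Q) (hV : pdf.IsUniform V (Set.Ioo (0 : ℝ) 1) Q)
    (hUV : IndepFun U V Q) :
    Integrable (fun ω => NormalVT.LB c σ (NormalVT.gapX n (U ω) (V ω))) Q ∧
    Integrable (fun ω => NormalVT.UB c σ (NormalVT.gapY n (U ω) (V ω))) Q ∧
    P.real (NormalVT.correctEvent c θ rew) ≥ P.real (NormalVT.beatsAllEvent c θ rew) ∧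
    P.real (NormalVT.beatsAllEvent c θ rew) ≥
      (∫ ω, NormalVT.LB c σ (NormalVT.gapX n (U ω) (V ω)) ∂Q) ^ (n - 1) ∧
    P.real (NormalVT.beatsAllEvent c θ rew) ≤
      ∫ ω, NormalVT.UB c σ (NormalVT.gapY n (U ω) (V ω)) ∂Q := by
  obtain ⟨k, rfl⟩ : ∃ k, n = k + 2 := ⟨n - 2, by omega⟩
  have hσ' : (0 : ℝ) < σ := hσ
  obtain ⟨hXi, hX0, hX⟩ := integrable_isUniform hU hV hUV
    (f := fun u v => LB c σ (gapX (k + 2) u v)) ((measurable_LB c σ).comp (measurable_gapX _))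
    fun u hu v hv => LB_mem_Icc hc hσ' (gapX_pos (by omega) hu hv)
  obtain ⟨hYi, hY0, hY⟩ := integrable_isUniform hU hV hUV
    (f := fun u v => UB c σ (gapY (k + 2) u v)) ((measurable_UB c σ).comp (measurable_gapY _))
    fun u hu v hv => UB_mem_Icc hc hσ' (gapY_pos (by omega) hu hv)
  refine ⟨hXi, hYi, measureReal_mono (beatsAllEvent_subset_correctEvent hc θ rew), ?_, ?_⟩
  · have := pow_le_measure_beatsAllEvent hbandit hσ hc
    rw [← hX, ← ENNReal.ofReal_pow hX0,
      ENNReal.ofReal_le_iff_le_toReal (measure_ne_top _ _)] at this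
    exact this
  · have := measure_beatsAllEvent_le hbandit hσ hc
    rw [← hY] at this
    exact ENNReal.toReal_le_of_le_ofReal hY0 this
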